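/- Let $K$ be a field, $X\subseteq\mathbb{R}$ a finite set and $b>0$ a real number. **Modules.** For a finite $Z\subseteq\mathbb{R}$ let $P_Z$ be the totally ordered set $Z$, and $P_Z^+=P_Z\cup\{\infty\}$ with $\infty$ as largest element. Finite-dimensional modules for the incidence algebra $A(P_Z)$ over $K$ are identified with functors from $P_Z^+$ to finite-dimensional $K$-vector spaces that vanish at $\infty$. Let $d$ be the weighted graph metric on the Hasse quiver of $P_Z^+$ in which consecutive points $z<z'$ of $Z$ are joined by an edge of length $z'-z$, and $\max Z$ and $\infty$ by an edge of length $b$. A translation is a monotone map $\Lambda:P_Z^+\to P_Z^+$ with $\Lambda p\ge p$ for all $p$; its height is $h(\Lambda)=\max_p d(p,\Lambda p)$, and $(M\Lambda)(p)=M(\Lambda p)$. A $(\Gamma,\Lambda)$-interleaving of $M$ and $N$ is a pair of morphisms $\phi:M\to N\Lambda$, $\psi:N\to M\Gamma$ such that $\psi\Lambda\circ\phi$ and $\phi\Gamma\circ\psi$ are the canonical morphisms $M\to M\Gamma\Lambda$ and $N\to N\Lambda\Gamma$ given by the structure maps. **Metrics.** The interleaving metric $D^Z(M,N)$ is the infimum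 of all $\epsilon$ for which there is a $(\Gamma,\Lambda)$-interleaving of $M$ and $N$ with $h(\Gamma),h(\Lambda)\le\epsilon$. The width $W(I)$ of an indecomposable $I$ is the least $\epsilon$ such that $\mathrm{Hom}(I,I\Lambda\Gamma)=0$ for some translations $\Lambda,\Gamma$ of height at most $\epsilon$. The barcode $B(M)$ is the multiset of isomorphism classes of the indecomposable summands of $M$. For $\epsilon \ge 0$, an $\epsilon$-matching of two barcodes is a bijection between multisubsets of them such that matched members have $D^Z$-distance at most $\epsilon$ and unmatched members have width at most $\epsilon$. The bottleneck metric $D_B^Z(M,N)$ is the infimum of all $\epsilon>0$ for which there is an $\epsilon$-matching of $B(M)$ and $B(N)$. **Shift refinement and inflation.** Let $N_1=\{|x-x'|:x,x'\in X\}$ and $Y=X\cup\{x-\epsilon:x\in X,\epsilon\in N_1\}=\{y_1>\dots>y_n\}$. Put $Z_0=Y$ and $Z_{i}=Z_{i-1}\cup\{z_i-\epsilon:\epsilon\in N_1\}$, where $z_i$ is the largest element of $Z_{i-1}$ with $z_i<y_i$ (and $Z_i=Z_{i-1}$ if there is none). The shift refinement of $X$ is $Sh(X)=Z_n$. The inflation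 functor $j=j(X,Sh(X)):A(P_X)\text{-mod}\to A(P_{Sh(X)})\text{-mod}$ sends $I$ to the module with $(jI)(y)=I(x_y)$, where $x_y$ is the largest element of $X$ with $x_y\le y$, and $(jI)(y)=0$ if there is none, with structure maps those of $I$ (or $0$), and acts on morphisms accordingly. Let $\mathcal{C}$ be the full subcategory of $A(P_{Sh(X)})$-mod given by the image of $j$ (closed under isomorphism). **Theorem (Shift Isometry Theorem).** 1. The identity $(\mathcal{C},D^{Sh(X)})\to(\mathcal{C},D_B^{Sh(X)})$ is an isometry: $D^{Sh(X)}(M,N)=D_B^{Sh(X)}(M,N)$ for all $M,N\in\mathcal{C}$. 2. The functor $j$ is a contraction from $(A(P_X)\text{-mod},D^X)$ to $(\mathcal{C},D^{Sh(X)})$ and from $(A(P_X)\text{-mod},D^X)$ to $(\mathcal{C},D_B^{Sh(X)})$: for all $A(P_X)$-modules $I,M$, both $D^{Sh(X)}(jI,jM)$ and $D_B^{Sh(X)}(jI,jM)$ are at most $D^X(I,M)$. 3. If $M,N\in\mathcal{C}$ are $(\Lambda,\Lambda)$-interleaved for a translation $\Lambda$ of $P_{Sh(X)}^+$, then there is an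 $h(\Lambda)$-matching of $B(M)$ and $B(N)$. -/

import Mathlib

open CategoryTheory CategoryTheory.Limits

universe u

noncomputable section

namespace ShiftIso

/-! ### Translations of a finite chain suspended at infinity, and their heights

For a finite set `X` of reals, `WithTop X` is the totally ordered set `X ∪ {∞}`. -/

/-- Length of the edge between two adjacent vertices of the Hasse quiver of `X ∪ {∞}`: consecutive
points `x`, `y` of `X` are joined by an edge of length `|x - y|`, and the edge from the maximum of
`X` to `∞` has length `b`. (Only values on edges are ever used.) -/
def edgeWeight (X : Finset ℝ) (b : ℝ) : WithTop X → WithTop X → ℝ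
  | some x, some y => |(x : ℝ) - (y : ℝ)|
  | none, none => 0
  | _, _ => b

/-- The weighted graph metric on the Hasse quiver of `X ∪ {∞}`. -/
def graphDist (X : Finset ℝ) (b : ℝ) (p q : WithTop X) : ℝ :=
  ⨅ w : (SimpleGraph.hasse (WithTop X)).Walk p q,
    (w.darts.map fun e => edgeWeight X b e.fst e.snd).sum

/-- Translations of `X ∪ {∞}`: monotone self-maps `Λ` with `p ≤ Λ p` for all `p`. -/
structure Translation (X : Finset ℝ) where
  toHom : WithTop X →o WithTop X
  le_apply : ∀ p, p ≤ toHom p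

instance (X : Finset ℝ) : CoeFun (Translation X) fun _ => WithTop X → WithTop X :=
  ⟨fun Λ => Λ.toHom⟩

/-- The height of a translation. -/
def Translation.height {X : Finset ℝ} (b : ℝ) (Λ : Translation X) : ℝ :=
  ⨆ p, graphDist X b p (Λ p)

theorem Translation.apply_top {X : Finset ℝ} (Λ : Translation X) : Λ ⊤ = ⊤ :=
  top_le_iff.mp (Λ.le_apply ⊤)

/-! ### Modules -/

/-- Representations of `X ∪ {∞}` in finite-dimensional `K`-vector spaces that vanish at `∞`. -/
def supportedInChain (K : Type u) [Field K] (X : Finset ℝ) :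
    ObjectProperty (WithTop X ⥤ FGModuleCat.{u} K) :=
  fun M => IsZero (M.obj ⊤)

/-- The category of finite-dimensional modules for the incidence algebra of the chain `X`, viewed
as the full subcategory of the persistence modules for `X ∪ {∞}` supported in `X`. -/
abbrev ChainMod (K : Type u) [Field K] (X : Finset ℝ) :=
  (supportedInChain K X).FullSubcategory

variable {K : Type u} [Field K] {X Y : Finset ℝ}

/-- The right action `M ↦ M Λ` of a translation, `(M Λ)(p) = M (Λ p)`, as a functor. -/
def shift (K : Type u) [Field K] {X : Finset ℝ} (Λ : Translation X) :
    ChainMod K X ⥤ ChainMod K X :=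
  (supportedInChain K X).lift
    ((supportedInChain K X).ι ⋙
      (Functor.whiskeringLeft _ _ (FGModuleCat.{u} K)).obj Λ.toHom.monotone.functor)
    (fun M => by
      have h : IsZero (M.obj.obj (Λ ⊤)) := by
        rw [Λ.apply_top]; exact M.property
      exact h)

/-- The canonical morphism `M ⟶ M Γ Λ`, given at `p` by `M (p ≤ Γ (Λ p))`. -/
def toShiftShift (M : ChainMod K X) (Γ Λ : Translation X) :
    M ⟶ (shift K Λ).obj ((shift K Γ).obj M) :=
  ObjectProperty.homMk
    { app := fun p => M.obj.map (homOfLE ((Λ.le_apply p).trans (Γ.le_apply (Λ p))))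
      naturality := by
        intro p q f
        change M.obj.map _ ≫ M.obj.map _ = M.obj.map _ ≫ M.obj.map _
        rw [← M.obj.map_comp, ← M.obj.map_comp]
        rfl }

/-- `M` and `N` are `(Γ, Λ)`-interleaved. -/
def Interleaved (Γ Λ : Translation X) (M N : ChainMod K X) : Prop :=
  ∃ (φ : M ⟶ (shift K Λ).obj N) (ψ : N ⟶ (shift K Γ).obj M),
    φ ≫ (shift K Λ).map ψ = toShiftShift M Γ Λ ∧
    ψ ≫ (shift K Γ).map φ = toShiftShift N Λ Γ

/-- The interleaving metric. -/
def interleavingDist (b : ℝ) (M N : ChainMod K X) : ℝ :=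
  sInf {ε | ∃ Γ Λ : Translation X, Γ.height b ≤ ε ∧ Λ.height b ≤ ε ∧ Interleaved Γ Λ M N}

/-- The width of a module: the least `ε` such that `Hom(I, I Λ Γ) = 0` for some translations
`Λ`, `Γ` of height at most `ε`. -/
def width (b : ℝ) (I : ChainMod K X) : ℝ :=
  sInf {ε | ∃ Λ Γ : Translation X, Λ.height b ≤ ε ∧ Γ.height b ≤ ε ∧
    ∀ f : I.obj ⟶ ((shift K Γ).obj ((shift K Λ).obj I)).obj, f = 0}

/-! ### Barcodes and the bottleneck metric -/

theorem toShiftShift_naturality {M N : ChainMod K X} (f : M ⟶ N) (Γ Λ : Translation X) :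
    f ≫ toShiftShift N Γ Λ = toShiftShift M Γ Λ ≫ (shift K Λ).map ((shift K Γ).map f) := by
  apply ObjectProperty.hom_ext
  ext p : 2
  exact (f.hom.naturality _).symm

theorem Interleaved.of_iso {Γ Λ : Translation X} {M M' N N' : ChainMod K X}
    (h : Interleaved Γ Λ M N) (e : M ≅ M') (f : N ≅ N') : Interleaved Γ Λ M' N' := by
  obtain ⟨φ, ψ, h₁, h₂⟩ := h
  refine ⟨e.inv ≫ φ ≫ (shift K Λ).map f.hom, f.inv ≫ ψ ≫ (shift K Γ).map e.hom, ?_, ?_⟩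
  · simp only [Category.assoc, ← Functor.map_comp, Iso.hom_inv_id_assoc]
    rw [Functor.map_comp, reassoc_of% h₁, ← toShiftShift_naturality, Iso.inv_hom_id_assoc]
  · simp only [Category.assoc, ← Functor.map_comp, Iso.hom_inv_id_assoc]
    rw [Functor.map_comp, reassoc_of% h₂, ← toShiftShift_naturality, Iso.inv_hom_id_assoc]

theorem interleavingDist_congr (b : ℝ) {M M' N N' : ChainMod K X} (e : M ≅ M') (f : N ≅ N') :
    interleavingDist b M N = interleavingDist b M' N' := by
  have : ∀ Γ Λ : Translation X, Interleaved Γ Λ M N ↔ Interleaved Γ Λ M' N' :=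
    fun Γ Λ => ⟨fun h => h.of_iso e f, fun h => h.of_iso e.symm f.symm⟩
  simp only [interleavingDist, this]

theorem width_congr (b : ℝ) {I I' : ChainMod K X} (e : I ≅ I') : width b I = width b I' := by
  have key : ∀ {I I' : ChainMod K X} (_ : I ≅ I') (Λ Γ : Translation X),
      (∀ f : I.obj ⟶ ((shift K Γ).obj ((shift K Λ).obj I)).obj, f = 0) →
      ∀ f : I'.obj ⟶ ((shift K Γ).obj ((shift K Λ).obj I')).obj, f = 0 := by
    intro I I' e Λ Γ h f
    have e₁ := (supportedInChain K X).ι.mapIso e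
    have e₂ := (supportedInChain K X).ι.mapIso ((shift K Γ).mapIso ((shift K Λ).mapIso e))
    have h0 : e₁.hom ≫ f ≫ e₂.inv = 0 := h _
    have : f = e₁.inv ≫ (e₁.hom ≫ f ≫ e₂.inv) ≫ e₂.hom := by simp
    rw [this, h0]; simp
  have : ∀ Λ Γ : Translation X, _ ↔ _ := fun Λ Γ => ⟨key e Λ Γ, key e.symm Λ Γ⟩
  simp only [width, this]

/-- The indecomposable modules. -/
def IsIndec (I : ChainMod K X) : Prop := Indecomposable I.obj

/-- Isomorphism classes of modules. -/
abbrev IsoClass (K : Type u) [Field K] (X : Finset ℝ) :=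
  Quotient (isIsomorphicSetoid (ChainMod K X))

/-- The isomorphism class of a module. -/
def isoClass (M : ChainMod K X) : IsoClass K X := Quotient.mk _ M

/-- The interleaving metric on isomorphism classes. -/
def classDist (b : ℝ) : IsoClass K X → IsoClass K X → ℝ :=
  Quotient.lift₂ (interleavingDist b) fun _ _ _ _ ⟨e⟩ ⟨f⟩ => interleavingDist_congr b e f

/-- The width of an isomorphism class. -/
def classWidth (b : ℝ) : IsoClass K X → ℝ :=
  Quotient.lift (width b) fun _ _ ⟨e⟩ => width_congr b e

instance (K : Type u) [Field K] (X : Finset ℝ) :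
    HasFiniteBiproducts (WithTop X ⥤ FGModuleCat.{u} K) :=
  Abelian.hasFiniteBiproducts

/-- The members of the finite family `F` are indecomposable, and `M` is isomorphic to their direct
sum. -/
def IsDecomposition (M : ChainMod K X) {ι : Type} [Finite ι] (F : ι → ChainMod K X) : Prop :=
  (∀ i, IsIndec (F i)) ∧ Nonempty (M.obj ≅ ⨁ fun i => (F i).obj)

/-- A direct sum over a disjoint union of index sets. -/
def biproductSumIso {C : Type*} [Category* C] [Preadditive C] [HasFiniteBiproducts C]
    [HasBinaryBiproducts C] {ι κ : Type} [Finite ι] [Finite κ] (H : ι ⊕ κ → C) :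
    (⨁ fun i => H (Sum.inl i)) ⊞ (⨁ fun k => H (Sum.inr k)) ≅ ⨁ H where
  hom := biprod.desc (biproduct.desc fun i => biproduct.ι H (Sum.inl i))
    (biproduct.desc fun k => biproduct.ι H (Sum.inr k))
  inv := biproduct.desc fun k => match k with
    | Sum.inl i => biproduct.ι (fun i => H (Sum.inl i)) i ≫ biprod.inl
    | Sum.inr i => biproduct.ι (fun i => H (Sum.inr i)) i ≫ biprod.inr
  hom_inv_id := by
    apply biprod.hom_ext' <;> apply biproduct.hom_ext' <;> intro i <;> simp
  inv_hom_id := by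
    apply biproduct.hom_ext'
    rintro (i | i) <;> simp

theorem IsDecomposition.sum {M A B : ChainMod K X} {ι κ : Type} [Finite ι] [Finite κ]
    {F : ι → ChainMod K X} {G : κ → ChainMod K X} (e : M.obj ≅ A.obj ⊞ B.obj)
    (hF : IsDecomposition A F) (hG : IsDecomposition B G) :
    IsDecomposition M (Sum.elim F G) := by
  obtain ⟨hF, ⟨f⟩⟩ := hF
  obtain ⟨hG, ⟨g⟩⟩ := hG
  exact ⟨by rintro (i | i); exacts [hF i, hG i], ⟨e ≪≫ biprod.mapIso f g ≪≫
    biproductSumIso fun k => (Sum.elim F G k).obj⟩⟩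

theorem IsDecomposition.reindex {M : ChainMod K X} {ι κ : Type} [Finite ι] [Finite κ]
    {F : ι → ChainMod K X} (hF : IsDecomposition M F) (e : κ ≃ ι) :
    IsDecomposition M (F ∘ e) := by
  obtain ⟨hF, ⟨f⟩⟩ := hF
  exact ⟨fun i => hF _, ⟨f ≪≫ (biproduct.reindex e fun i => (F i).obj).symm⟩⟩

/-- Total dimension of a representation. -/
def totalDim (M : WithTop X ⥤ FGModuleCat.{u} K) : ℕ :=
  ∑ p, Module.finrank K (M.obj p)

theorem totalDim_congr {M N : WithTop X ⥤ FGModuleCat.{u} K} (e : M ≅ N) :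
    totalDim M = totalDim N :=
  Finset.sum_congr rfl fun p _ => (FGModuleCat.isoToLinearEquiv (e.app p)).finrank_eq

theorem totalDim_biprod (A B : WithTop X ⥤ FGModuleCat.{u} K) :
    totalDim (A ⊞ B) = totalDim A + totalDim B := by
  simp only [totalDim, ← Finset.sum_add_distrib]
  refine Finset.sum_congr rfl fun p _ => ?_
  have h₁ : (biprod.inl : A ⟶ A ⊞ B).app p ≫ (biprod.fst : A ⊞ B ⟶ A).app p = 𝟙 _ := by
    rw [← NatTrans.comp_app, biprod.inl_fst, NatTrans.id_app]
  have h₂ : (biprod.inl : A ⟶ A ⊞ B).app p ≫ (biprod.snd : A ⊞ B ⟶ B).app p = 0 := by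
    rw [← NatTrans.comp_app, biprod.inl_snd]; rfl
  have h₃ : (biprod.inr : B ⟶ A ⊞ B).app p ≫ (biprod.fst : A ⊞ B ⟶ A).app p = 0 := by
    rw [← NatTrans.comp_app, biprod.inr_fst]; rfl
  have h₄ : (biprod.inr : B ⟶ A ⊞ B).app p ≫ (biprod.snd : A ⊞ B ⟶ B).app p = 𝟙 _ := by
    rw [← NatTrans.comp_app, biprod.inr_snd, NatTrans.id_app]
  have h₅ : (biprod.fst : A ⊞ B ⟶ A).app p ≫ (biprod.inl : A ⟶ A ⊞ B).app p +
      (biprod.snd : A ⊞ B ⟶ B).app p ≫ (biprod.inr : B ⟶ A ⊞ B).app p = 𝟙 _ := by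
    rw [← NatTrans.comp_app, ← NatTrans.comp_app, ← NatTrans.app_add, biprod.total,
      NatTrans.id_app]
  rw [← Module.finrank_prod]
  refine LinearEquiv.finrank_eq (LinearEquiv.ofLinearMap
    (((biprod.fst : A ⊞ B ⟶ A).app p).hom.hom.prod ((biprod.snd : A ⊞ B ⟶ B).app p).hom.hom)
    (((biprod.inl : A ⟶ A ⊞ B).app p).hom.hom.coprod ((biprod.inr : B ⟶ A ⊞ B).app p).hom.hom)
    ?_ ?_)
  · apply LinearMap.prod_ext <;> apply LinearMap.ext <;> intro v <;> apply Prod.ext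
    · simpa using congrArg (fun t => t.hom.hom v) h₁
    · simpa using congrArg (fun t => t.hom.hom v) h₂
    · simpa using congrArg (fun t => t.hom.hom v) h₃
    · simpa using congrArg (fun t => t.hom.hom v) h₄
  · apply LinearMap.ext
    intro v
    exact congrArg (fun t => t.hom.hom v) h₅

theorem isZero_of_totalDim_eq_zero {M : WithTop X ⥤ FGModuleCat.{u} K} (h : totalDim M = 0) :
    IsZero M := by
  refine Functor.isZero M fun p => ?_
  have h0 : Module.finrank K (M.obj p) = 0 :=
    Finset.sum_eq_zero_iff.mp h p (Finset.mem_univ p)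
  have : Subsingleton (M.obj p) := Module.finrank_zero_iff.mp h0
  rw [IsZero.iff_id_eq_zero]
  ext v
  exact Subsingleton.elim (α := M.obj p) _ _

theorem isZero_of_split {C : Type*} [Category* C] [HasZeroMorphisms C] {A B : C}
    (h : IsZero B) (i : A ⟶ B) (r : B ⟶ A) (hir : i ≫ r = 𝟙 A) : IsZero A := by
  rw [IsZero.iff_id_eq_zero, ← hir, h.eq_zero_of_tgt i, zero_comp]

theorem exists_isDecomposition (M : ChainMod K X) :
    ∃ (n : ℕ) (F : Fin n → ChainMod K X), IsDecomposition M F := by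
  suffices H : ∀ (d : ℕ) (M : ChainMod K X), totalDim M.obj ≤ d →
      ∃ (ι : Type) (_ : Finite ι) (F : ι → ChainMod K X), IsDecomposition M F by
    obtain ⟨ι, _, F, hF⟩ := H _ M le_rfl
    exact ⟨_, _, hF.reindex (Finite.equivFin ι).symm⟩
  intro d
  induction d with
  | zero =>
    intro M hM
    have hz := isZero_of_totalDim_eq_zero (Nat.le_zero.mp hM)
    refine ⟨Empty, inferInstance, Empty.elim, fun i => i.elim, ⟨hz.iso ?_⟩⟩
    rw [IsZero.iff_id_eq_zero]
    apply biproduct.hom_ext'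
    rintro ⟨⟩
  | succ d ih =>
    intro M hM
    by_cases hz : IsZero M.obj
    · refine ⟨Empty, inferInstance, Empty.elim, fun i => i.elim, ⟨hz.iso ?_⟩⟩
      rw [IsZero.iff_id_eq_zero]
      apply biproduct.hom_ext'
      rintro ⟨⟩
    by_cases hi : IsIndec M
    · exact ⟨Unit, inferInstance, fun _ => M, fun _ => hi,
        ⟨(biproductUniqueIso fun _ : Unit => M.obj).symm⟩⟩
    · simp only [IsIndec, Indecomposable, hz, not_false_eq_true, true_and] at hi
      push Not at hi
      obtain ⟨A, B, e, hA, hB⟩ := hi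
      have hdim := (totalDim_congr e).trans (totalDim_biprod A B)
      have hA₀ : totalDim A ≠ 0 := fun h => hA (isZero_of_totalDim_eq_zero h)
      have hB₀ : totalDim B ≠ 0 := fun h => hB (isZero_of_totalDim_eq_zero h)
      have hA₁ : supportedInChain K X A :=
        isZero_of_split M.property ((biprod.inl ≫ e.inv).app ⊤) ((e.hom ≫ biprod.fst).app ⊤) (by
          rw [← NatTrans.comp_app]; simp)
      have hB₁ : supportedInChain K X B :=
        isZero_of_split M.property ((biprod.inr ≫ e.inv).app ⊤) ((e.hom ≫ biprod.snd).app ⊤) (by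
          rw [← NatTrans.comp_app]; simp)
      obtain ⟨ι, _, F, hF⟩ := ih ⟨A, hA₁⟩ (show totalDim A ≤ d by omega)
      obtain ⟨κ, _, G, hG⟩ := ih ⟨B, hB₁⟩ (show totalDim B ≤ d by omega)
      exact ⟨ι ⊕ κ, inferInstance, _, IsDecomposition.sum (A := ⟨A, hA₁⟩) (B := ⟨B, hB₁⟩) e hF hG⟩

/-- The barcode: the multiset of isomorphism classes of indecomposable summands. -/
def barcode (M : ChainMod K X) : Multiset (IsoClass K X) :=
  Finset.univ.val.map fun i => isoClass ((exists_isDecomposition M).choose_spec.choose i)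

/-- There is an `ε`-matching between the multisets `S` and `T`: a bijection between the
multisubsets `R.map Prod.fst` of `S` and `R.map Prod.snd` of `T` given by the multiset `R` of
matched pairs, with the members of `S` and `T` in the complements `S₀` and `T₀` unmatched. -/
def ExistsMatching (b ε : ℝ) (S T : Multiset (IsoClass K X)) : Prop :=
  ∃ (R : Multiset (IsoClass K X × IsoClass K X)) (S₀ T₀ : Multiset (IsoClass K X)),
    S = R.map Prod.fst + S₀ ∧ T = R.map Prod.snd + T₀ ∧
    (∀ s ∈ S₀, classWidth b s ≤ ε) ∧ (∀ t ∈ T₀, classWidth b t ≤ ε) ∧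
    ∀ r ∈ R, classDist b r.1 r.2 ≤ ε

/-- The bottleneck metric. -/
def bottleneckDist (b : ℝ) (M N : ChainMod K X) : ℝ :=
  sInf {ε | 0 < ε ∧ ExistsMatching b ε (barcode M) (barcode N)}

/-! ### Inflation -/

/-- The inclusion `X ∪ {∞} → Y ∪ {∞}`. -/
def chainIncl (h : X ⊆ Y) : WithTop X → WithTop Y :=
  WithTop.map fun x => ⟨x.1, h x.2⟩

/-- The maximal elements `x ≤ y` of `X ∪ {∞}`: there is at most one, and none if and only
if no element of `X` lies below `y`. -/
def Floor (h : X ⊆ Y) (y : WithTop Y) : Type :=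
  {x : WithTop X // IsGreatest {x | chainIncl h x ≤ y} x}

instance (h : X ⊆ Y) (y : WithTop Y) : Finite (Floor h y) := Subtype.finite

instance (h : X ⊆ Y) (y : WithTop Y) : Subsingleton (Floor h y) :=
  ⟨fun a c => Subtype.ext (a.2.unique c.2)⟩

theorem Floor.mono {h : X ⊆ Y} {y₁ y₂ : WithTop Y} (hy : y₁ ≤ y₂) (x₁ : Floor h y₁)
    (x₂ : Floor h y₂) : x₁.1 ≤ x₂.1 :=
  x₂.2.2 (le_trans (show chainIncl h x₁.1 ≤ y₁ from x₁.2.1) hy)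

open Classical in
/-- The structure map `M(x₁ ≤ x₂)` of the inflation of `M`, where `x₁` and `x₂` are maximal in `X`
with `x₁ ≤ y₁` and `x₂ ≤ y₂`; it is `0` if there is no such `x₁`. -/
def inflateStr (h : X ⊆ Y) (M : WithTop X ⥤ FGModuleCat.{u} K) {y₁ y₂ : WithTop Y}
    (hy : y₁ ≤ y₂) :
    (∀ x : Floor h y₁, M.obj x.1) →ₗ[K] (∀ x : Floor h y₂, M.obj x.1) :=
  LinearMap.pi fun x₂ =>
    if h₁ : Nonempty (Floor h y₁) then
      (M.map (homOfLE (Floor.mono hy h₁.some x₂))).hom.hom ∘ₗ LinearMap.proj h₁.some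
    else 0

theorem inflateStr_apply (h : X ⊆ Y) (M : WithTop X ⥤ FGModuleCat.{u} K) {y₁ y₂ : WithTop Y}
    (hy : y₁ ≤ y₂) (v : ∀ x : Floor h y₁, M.obj x.1) (x₁ : Floor h y₁) (x₂ : Floor h y₂) :
    inflateStr h M hy v x₂ = (M.map (homOfLE (Floor.mono hy x₁ x₂))).hom.hom (v x₁) := by
  have h₁ : Nonempty (Floor h y₁) := ⟨x₁⟩
  obtain rfl : h₁.some = x₁ := Subsingleton.elim _ _
  simp only [inflateStr, LinearMap.pi_apply, dif_pos h₁]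
  rfl

theorem inflateStr_apply_of_isEmpty (h : X ⊆ Y) (M : WithTop X ⥤ FGModuleCat.{u} K)
    {y₁ y₂ : WithTop Y} (hy : y₁ ≤ y₂) (v : ∀ x : Floor h y₁, M.obj x.1)
    (h₁ : ¬ Nonempty (Floor h y₁)) (x₂ : Floor h y₂) : inflateStr h M hy v x₂ = 0 := by
  simp only [inflateStr, LinearMap.pi_apply, dif_neg h₁]
  rfl

theorem Floor.nonempty_of_le {h : X ⊆ Y} {y₁ y₂ : WithTop Y} (hy : y₁ ≤ y₂) (x₁ : Floor h y₁) :
    Nonempty (Floor h y₂) := by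
  obtain ⟨x, hx, hmax⟩ := Set.exists_max_image {x | chainIncl h x ≤ y₂} id (Set.toFinite _)
    ⟨x₁.1, le_trans (show chainIncl h x₁.1 ≤ y₁ from x₁.2.1) hy⟩
  exact ⟨⟨x, hx, fun z hz => hmax z hz⟩⟩

/-- The inflation of a module. Its value at `y` is `M x` if `x` is maximal in `X` with `x ≤ y`
(the product over the one-element type of such `x`), and `0` (the empty product) if there
is no such `x`. -/
def inflateObj (h : X ⊆ Y) (M : WithTop X ⥤ FGModuleCat.{u} K) :
    WithTop Y ⥤ FGModuleCat.{u} K where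
  obj y := FGModuleCat.of K (∀ x : Floor h y, M.obj x.1)
  map f := FGModuleCat.ofHom (inflateStr h M (leOfHom f))
  map_id y := by
    apply FGModuleCat.hom_ext
    apply LinearMap.ext
    intro v
    funext x
    refine (inflateStr_apply h M le_rfl v x x).trans ?_
    exact congrArg (fun t => t.hom.hom (v x)) (M.map_id x.1)
  map_comp {y₁ y₂ y₃} f g := by
    apply FGModuleCat.hom_ext
    apply LinearMap.ext
    intro v
    funext x₃
    change inflateStr h M (leOfHom (f ≫ g)) v x₃ =
      inflateStr h M (leOfHom g) (inflateStr h M (leOfHom f) v) x₃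
    by_cases h₁ : Nonempty (Floor h y₁)
    · obtain ⟨x₁⟩ := h₁
      obtain ⟨x₂⟩ := Floor.nonempty_of_le (leOfHom f) x₁
      rw [inflateStr_apply h M _ v x₁ x₃, inflateStr_apply h M _ _ x₂ x₃,
        inflateStr_apply h M _ v x₁ x₂]
      exact congrArg (fun t => t.hom.hom (v x₁))
        (M.map_comp (homOfLE (Floor.mono (leOfHom f) x₁ x₂))
          (homOfLE (Floor.mono (leOfHom g) x₂ x₃)))
    · have h0 : inflateStr h M (leOfHom f) v = 0 :=
        funext fun x₂ => inflateStr_apply_of_isEmpty h M _ v h₁ x₂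
      rw [inflateStr_apply_of_isEmpty h M _ v h₁ x₃, h0, map_zero]
      rfl

/-- The inflation of a morphism `α`, given at `y` by `α x`, where `x` is maximal in `X` with
`x ≤ y`. -/
def inflateMap (h : X ⊆ Y) {M N : WithTop X ⥤ FGModuleCat.{u} K} (α : M ⟶ N) :
    inflateObj h M ⟶ inflateObj h N where
  app y := FGModuleCat.ofHom (V := ∀ x : Floor h y, M.obj x.1) (W := ∀ x : Floor h y, N.obj x.1)
    (LinearMap.pi fun x => (α.app x.1).hom.hom ∘ₗ LinearMap.proj x)
  naturality y₁ y₂ f := by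
    apply FGModuleCat.hom_ext
    apply LinearMap.ext
    intro v
    funext x₂
    change (α.app x₂.1).hom.hom (inflateStr h M (leOfHom f) v x₂) =
      inflateStr h N (leOfHom f) (fun x => (α.app x.1).hom.hom (v x)) x₂
    by_cases h₁ : Nonempty (Floor h y₁)
    · obtain ⟨x₁⟩ := h₁
      rw [inflateStr_apply h M _ v x₁ x₂, inflateStr_apply h N _ _ x₁ x₂]
      exact congrArg (fun t => t.hom.hom (v x₁))
        (α.naturality (homOfLE (Floor.mono (leOfHom f) x₁ x₂)))
    · rw [inflateStr_apply_of_isEmpty h M _ v h₁ x₂, inflateStr_apply_of_isEmpty h N _ _ h₁ x₂,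
        map_zero]

/-- The inflation functor `j(X, Y)` for `X ⊆ Y`. -/
def inflation (K : Type u) [Field K] (h : X ⊆ Y) : ChainMod K X ⥤ ChainMod K Y where
  obj M := ⟨inflateObj h M.obj, by
    have hz : IsZero (M.obj.obj ⊤) := M.property
    change IsZero (FGModuleCat.of K (∀ x : Floor h ⊤, M.obj.obj x.1))
    rw [IsZero.iff_id_eq_zero]
    apply FGModuleCat.hom_ext
    apply LinearMap.ext
    intro v
    funext x
    obtain ⟨x, hx⟩ := x
    obtain rfl : x = ⊤ := top_le_iff.mp (hx.2 (show chainIncl h ⊤ ≤ ⊤ from le_top))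
    exact congrArg (fun t => t.hom.hom (v ⟨⊤, hx⟩)) ((IsZero.iff_id_eq_zero _).mp hz)⟩
  map α := ObjectProperty.homMk (inflateMap h α.hom)
  map_id _ := rfl
  map_comp _ _ := rfl

/-! ### The shift refinement -/

/-- The set of distances between points of `X`. -/
def distances (X : Finset ℝ) : Finset ℝ :=
  (X ×ˢ X).image fun p => |p.1 - p.2|

/-- The set `X ∪ {x - ε : x ∈ X, ε ∈ distances X}`. -/
def firstRefinement (X : Finset ℝ) : Finset ℝ :=
  X ∪ (X ×ˢ distances X).image fun p => p.1 - p.2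

/-- One step of the construction: add to `Z` all `z - ε` with `ε ∈ N`, where `z` is the largest
element of `Z` with `z < y` (if there is one). -/
def shiftStep (N Z : Finset ℝ) (y : ℝ) : Finset ℝ :=
  if h : (Z.filter (· < y)).Nonempty then
    Z ∪ N.image fun ε => (Z.filter (· < y)).max' h - ε
  else Z

/-- The shift refinement of `X`: starting from `firstRefinement X`, perform the above step for all
`y ∈ firstRefinement X` successively, from the greatest to the least. -/
def shiftRefinement (X : Finset ℝ) : Finset ℝ :=
  ((firstRefinement X).sort (· ≥ ·)).foldl (shiftStep (distances X)) (firstRefinement X)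

theorem subset_shiftRefinement (X : Finset ℝ) : X ⊆ shiftRefinement X := by
  have step : ∀ N Z : Finset ℝ, ∀ y, Z ⊆ shiftStep N Z y := by
    intro N Z y
    unfold shiftStep
    split_ifs
    exacts [Finset.subset_union_left, subset_rfl]
  have fold : ∀ (N : Finset ℝ) (l : List ℝ) (Z : Finset ℝ), Z ⊆ l.foldl (shiftStep N) Z := by
    intro N l
    induction l with
    | nil => exact fun Z => subset_rfl
    | cons y l ih => exact fun Z => (step N Z y).trans (ih _)
  exact Finset.subset_union_left.trans (fold _ _ _)

/-- The inflation functor from modules for `X` to modules for its shift refinement. -/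
abbrev shiftInflation (K : Type u) [Field K] (X : Finset ℝ) :
    ChainMod K X ⥤ ChainMod K (shiftRefinement X) :=
  inflation K (subset_shiftRefinement X)

end ShiftIso

end

noncomputable section

namespace ShiftIso

section

/-! ### Positions and heights -/

/-! The isometry is proved over an arbitrary finite chain. Its vertices are placed on the real line
by `pos`, so that the graph metric becomes a difference of positions. Among the translations of
height at most `ε` there is then a largest, `maxTranslation`, characterised by `q ≤ Λ p ↔ pos q ≤
pos p + ε`. Interleavings survive enlarging the translations, so distance at most `ε` means being
interleaved by this one translation (`interleavingDist_le_iff`), and questions about intervals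
become linear inequalities between endpoints.

From interleaving to matching: indecomposables are intervals `[a, c)` (`exists_isInterval`). Written
in bars, an interleaving gives two matrices. On the bars of `M` with `Λ (Λ a) < c`, ordered by `a +
c`, their product is unitriangular, and a nonzero term on or above the diagonal passes through a bar
of `N` that is close to one of its two outer bars (`close_or_close`). Injectivity of unitriangular
matrices is then exactly Hall's condition (`exists_injective_of_unitriangular`), so the long bars of
`M` embed into close bars of `N`, and symmetrically. An alternating path argument in the style of
Cantor and Bernstein merges the two injections (`exists_matching_covering`); bars left over have
small width.

From matching to interleaving: add up the interleavings of the matched summands and use zero on the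
others, whose canonical morphisms vanish (`interleaved_of_matching`).

Contraction: an interleaving inflates along any pair of dominating translations
(`Interleaved.inflation`). The shift refinement has no point above all of `X`, so positions agree in
both chains and the largest translation of height `ε` on the refinement dominates the one on `X`.
The bottleneck version follows from the isometry. -/

/-- The position of a point of `X ∪ {∞}` on the real line, with `∞` placed at distance `b` to the
right of the maximum of `X`. -/
def pos (X : Finset ℝ) (b : ℝ) : WithTop X → ℝ
  | some x => x
  | none => b + if h : X.Nonempty then X.max' h else 0

theorem pos_coe (X : Finset ℝ) (b : ℝ) (x : X) : pos X b (x : WithTop X) = x := rfl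

theorem pos_top (X : Finset ℝ) (b : ℝ) (h : X.Nonempty) :
    pos X b ⊤ = b + X.max' h := by
  change b + _ = _
  rw [dif_pos h]

theorem pos_strictMono (X : Finset ℝ) {b : ℝ} (hb : 0 < b) : StrictMono (pos X b) := by
  intro p q hpq
  induction p using WithTop.recTopCoe with
  | top => exact absurd hpq not_top_lt
  | coe x =>
    induction q using WithTop.recTopCoe with
    | top =>
      rw [pos_top X b ⟨x, x.2⟩, pos_coe]
      have := X.le_max' x x.2
      linarith
    | coe y => exact (WithTop.coe_lt_coe (α := X)).mp hpq

theorem pos_le_pos {X : Finset ℝ} {b : ℝ} (hb : 0 < b) {p q : WithTop X} :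
    pos X b p ≤ pos X b q ↔ p ≤ q := (pos_strictMono X hb).le_iff_le

theorem coe_covBy_top {X : Finset ℝ} {x : X} (h : (x : WithTop X) ⋖ ⊤) :
    (x : ℝ) = X.max' ⟨x, x.2⟩ := by
  refine le_antisymm (X.le_max' x x.2) (Finset.max'_le _ _ _ fun y hy => ?_)
  by_contra hlt
  exact h.2 (c := ((⟨y, hy⟩ : X) : WithTop X)) (WithTop.coe_lt_coe.mpr (not_le.mp hlt))
    (WithTop.coe_lt_top _)

/-- The only neighbour of `∞` is the maximum of `X`, and `pos` places `∞` exactly `b` beyond it. -/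
theorem edgeWeight_eq {X : Finset ℝ} {b : ℝ} (hb : 0 < b) {p q : WithTop X}
    (h : (SimpleGraph.hasse (WithTop X)).Adj p q) :
    edgeWeight X b p q = |pos X b p - pos X b q| := by
  rw [SimpleGraph.hasse_adj] at h
  induction p using WithTop.recTopCoe with
  | top =>
    induction q using WithTop.recTopCoe with
    | top => exact absurd h (by simp)
    | coe y =>
      have h' := h.resolve_left fun h => not_top_lt h.lt
      rw [pos_top X b ⟨y, y.2⟩, pos_coe, ← coe_covBy_top h', add_sub_cancel_right, abs_of_pos hb]
      rfl
  | coe x =>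
    induction q using WithTop.recTopCoe with
    | top =>
      have h' := h.resolve_right fun h => not_top_lt h.lt
      rw [pos_top X b ⟨x, x.2⟩, pos_coe, ← coe_covBy_top h', abs_sub_comm, add_sub_cancel_right,
        abs_of_pos hb]
      rfl
    | coe y => rfl

theorem abs_pos_sub_le_length {X : Finset ℝ} {b : ℝ} (hb : 0 < b) {p q : WithTop X}
    (w : (SimpleGraph.hasse (WithTop X)).Walk p q) :
    |pos X b p - pos X b q| ≤ (w.darts.map fun e => edgeWeight X b e.fst e.snd).sum := by
  induction w with
  | nil => simp
  | cons h w ih =>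
    rw [SimpleGraph.Walk.darts_cons, List.map_cons, List.sum_cons, edgeWeight_eq hb h]
    exact (abs_sub_le _ _ _).trans (by gcongr)

theorem exists_walk_length_eq {X : Finset ℝ} {b : ℝ} (hb : 0 < b) (p : WithTop X) :
    ∀ q, q ≤ p → ∃ w : (SimpleGraph.hasse (WithTop X)).Walk q p,
      (w.darts.map fun e => edgeWeight X b e.fst e.snd).sum = pos X b p - pos X b q := by
  intro q
  induction q using WellFoundedGT.induction with
  | ind q ih =>
    intro hqp
    rcases hqp.eq_or_lt with rfl | hlt
    · exact ⟨SimpleGraph.Walk.nil, by simp⟩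
    · obtain ⟨r, hqr, hrp⟩ := exists_covBy_le_of_lt hlt
      obtain ⟨w, hw⟩ := ih r hqr.lt hrp
      have hadj : (SimpleGraph.hasse (WithTop X)).Adj q r := by
        rw [SimpleGraph.hasse_adj]; exact Or.inl hqr
      refine ⟨SimpleGraph.Walk.cons hadj w, ?_⟩
      rw [SimpleGraph.Walk.darts_cons, List.map_cons, List.sum_cons, edgeWeight_eq hb hadj, hw,
        abs_sub_comm, abs_of_nonneg (sub_nonneg.mpr ((pos_le_pos hb).mpr hqr.le))]
      ring

/-- The triangle inequality bounds every walk from below, and the walk climbing through successive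
covers attains the bound. -/
theorem graphDist_of_le {X : Finset ℝ} {b : ℝ} (hb : 0 < b) {p q : WithTop X} (h : p ≤ q) :
    graphDist X b p q = pos X b q - pos X b p := by
  obtain ⟨w, hw⟩ := exists_walk_length_eq hb q p h
  have : Nonempty ((SimpleGraph.hasse (WithTop X)).Walk p q) := ⟨w⟩
  refine le_antisymm ?_ (le_ciInf fun w => ?_)
  · rw [← hw]
    exact ciInf_le ⟨|pos X b p - pos X b q|, by
      rintro _ ⟨w, rfl⟩; exact abs_pos_sub_le_length hb w⟩ w
  · refine le_trans ?_ (abs_pos_sub_le_length hb w)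
    rw [abs_sub_comm]
    exact le_abs_self _

variable {X : Finset ℝ} {b : ℝ}

theorem Translation.height_le_iff (hb : 0 < b) (Λ : Translation X) {ε : ℝ} :
    Λ.height b ≤ ε ↔ ∀ p, pos X b (Λ p) ≤ pos X b p + ε := by
  have h : ∀ p, graphDist X b p (Λ p) = pos X b (Λ p) - pos X b p :=
    fun p => graphDist_of_le hb (Λ.le_apply p)
  refine ⟨fun hε p => ?_, fun hε => ciSup_le fun p => ?_⟩
  · have := (le_ciSup (Set.finite_range fun p => graphDist X b p (Λ p)).bddAbove p).trans hε
    simp only [h] at this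
    linarith
  · have := hε p
    rw [h]
    linarith

theorem Translation.height_nonneg (hb : 0 < b) (Λ : Translation X) : 0 ≤ Λ.height b := by
  have := (Λ.height_le_iff hb).mp le_rfl ⊤
  rw [Λ.apply_top] at this
  linarith

/-! ### The largest translation of bounded height, and attained infima -/

open Classical in
theorem nearby_nonempty (b : ℝ) {ε : ℝ} (hε : 0 ≤ ε) (p : WithTop X) :
    (Finset.univ.filter fun q => pos X b q ≤ pos X b p + ε).Nonempty :=
  ⟨p, by simp [hε]⟩

open Classical in
/-- The largest translation of height at most `ε`. -/
def maxTranslation (X : Finset ℝ) (b : ℝ) (hb : 0 < b) (ε : ℝ) (hε : 0 ≤ ε) : Translation X where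
  toHom :=
    { toFun := fun p => Finset.max' _ (nearby_nonempty b hε p)
      monotone' := fun p q hpq => by
        refine Finset.max'_subset _ fun r hr => ?_
        rw [Finset.mem_filter] at hr ⊢
        exact ⟨hr.1, hr.2.trans (by gcongr; exact (pos_le_pos hb).mpr hpq)⟩ }
  le_apply p := Finset.le_max' _ _ (by simp [hε])

/-- The working description of the largest translation. General translations have no such
description, which is why the matching argument is run only with this one. -/
theorem le_maxTranslation_iff (hb : 0 < b) {ε : ℝ} (hε : 0 ≤ ε) {p q : WithTop X} :
    q ≤ maxTranslation X b hb ε hε p ↔ pos X b q ≤ pos X b p + ε := by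
  classical
  refine ⟨fun h => ?_, fun h => Finset.le_max' _ _ (by simp [h])⟩
  have := Finset.max'_mem _ (nearby_nonempty b hε p)
  rw [Finset.mem_filter] at this
  exact ((pos_le_pos hb).mpr h).trans this.2

theorem height_maxTranslation_le (hb : 0 < b) {ε : ℝ} (hε : 0 ≤ ε) :
    (maxTranslation X b hb ε hε).height b ≤ ε :=
  (Translation.height_le_iff hb _).mpr fun _ => (le_maxTranslation_iff hb hε).mp le_rfl

theorem Translation.le_maxTranslation (hb : 0 < b) {Λ : Translation X} {ε : ℝ} (hε : 0 ≤ ε)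
    (h : Λ.height b ≤ ε) (p : WithTop X) : Λ p ≤ maxTranslation X b hb ε hε p :=
  (le_maxTranslation_iff hb hε).mpr ((Λ.height_le_iff hb).mp h p)

/-- The translation that is constant with value `∞`. -/
def topTranslation (X : Finset ℝ) : Translation X where
  toHom := ⟨fun _ => ⊤, fun _ _ _ => le_rfl⟩
  le_apply _ := le_top

instance : Finite (Translation X) :=
  Finite.of_injective (fun Λ : Translation X => (Λ : WithTop X → WithTop X)) fun Λ Γ h => by
    cases Λ; cases Γ; congr; exact DFunLike.coe_injective h

/-- An infimum over finitely many translations with a bound on the heights is attained. -/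
theorem exists_of_sInf_le {P : Translation X → Translation X → Prop} (hP : ∃ Γ Λ, P Γ Λ) {ε : ℝ}
    (h : sInf {ε | ∃ Γ Λ : Translation X, Γ.height b ≤ ε ∧ Λ.height b ≤ ε ∧ P Γ Λ} ≤ ε) :
    ∃ Γ Λ : Translation X, Γ.height b ≤ ε ∧ Λ.height b ≤ ε ∧ P Γ Λ := by
  obtain ⟨Γ₀, Λ₀, h₀⟩ := hP
  -- A finite chain has finitely many translations, so some admissible pair minimises the larger
  -- height.
  obtain ⟨⟨Γ, Λ⟩, hΓΛ, hmin⟩ := Set.exists_min_image {t : Translation X × Translation X | P t.1 t.2}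
    (fun t => max (t.1.height b) (t.2.height b)) (Set.toFinite _) ⟨(Γ₀, Λ₀), h₀⟩
  have hle : max (Γ.height b) (Λ.height b) ≤ ε := by
    refine (le_csInf ?_ ?_).trans h
    · exact ⟨_, Γ₀, Λ₀, le_max_left _ _, le_max_right _ _, h₀⟩
    · rintro δ ⟨Γ', Λ', h₁, h₂, h₃⟩
      exact (hmin (Γ', Λ') h₃).trans (max_le h₁ h₂)
  exact ⟨Γ, Λ, (le_max_left _ _).trans hle, (le_max_right _ _).trans hle, hΓΛ⟩

theorem sInf_le_of_exists (hb : 0 < b) {P : Translation X → Translation X → Prop} {ε : ℝ}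
    (h : ∃ Γ Λ : Translation X, Γ.height b ≤ ε ∧ Λ.height b ≤ ε ∧ P Γ Λ) :
    sInf {ε | ∃ Γ Λ : Translation X, Γ.height b ≤ ε ∧ Λ.height b ≤ ε ∧ P Γ Λ} ≤ ε :=
  csInf_le ⟨0, fun _ ⟨Γ, _, h, _⟩ => (Γ.height_nonneg hb).trans h⟩ h

end

section

/-! ### Bars in a representation -/

variable {K : Type u} [Field K] {X : Finset ℝ}

/-- The structure map of a representation as a linear map. -/
def str (V : WithTop X ⥤ FGModuleCat.{u} K) {p q : WithTop X} (h : p ≤ q) :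
    V.obj p →ₗ[K] V.obj q :=
  (V.map (homOfLE h)).hom.hom

/-- The component of a morphism of representations as a linear map. -/
def comp {V W : WithTop X ⥤ FGModuleCat.{u} K} (α : V ⟶ W) (p : WithTop X) :
    V.obj p →ₗ[K] W.obj p :=
  (α.app p).hom.hom

theorem str_refl (V : WithTop X ⥤ FGModuleCat.{u} K) {p : WithTop X} (h : p ≤ p) (x : V.obj p) :
    str V h x = x :=
  congrArg (fun t => t.hom.hom x) (V.map_id p)

theorem str_str (V : WithTop X ⥤ FGModuleCat.{u} K) {p q r : WithTop X} (h : p ≤ q) (h' : q ≤ r)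
    (x : V.obj p) : str V h' (str V h x) = str V (h.trans h') x :=
  (congrArg (fun t => t.hom.hom x) (V.map_comp (homOfLE h) (homOfLE h'))).symm

theorem comp_str {V W : WithTop X ⥤ FGModuleCat.{u} K} (α : V ⟶ W) {p q : WithTop X} (h : p ≤ q)
    (x : V.obj p) : comp α q (str V h x) = str W h (comp α p x) :=
  congrArg (fun t => t.hom.hom x) (α.naturality (homOfLE h))

theorem hom_ext_comp {V W : WithTop X ⥤ FGModuleCat.{u} K} {α β : V ⟶ W}
    (h : ∀ p x, comp α p x = comp β p x) : α = β := by
  apply NatTrans.ext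
  funext p
  apply FGModuleCat.hom_ext
  exact LinearMap.ext (h p)

/-- A morphism of representations from a natural family of linear maps. -/
def mkHom {V W : WithTop X ⥤ FGModuleCat.{u} K} (f : ∀ p, V.obj p →ₗ[K] W.obj p)
    (hf : ∀ {p q : WithTop X} (h : p ≤ q) (x : V.obj p), f q (str V h x) = str W h (f p x)) :
    V ⟶ W where
  app p := FGModuleCat.ofHom (f p)
  naturality p q h := by
    apply FGModuleCat.hom_ext
    exact LinearMap.ext (hf (leOfHom h))

theorem eq_zero_of_isZero {A : FGModuleCat.{u} K} (h : IsZero A) (x : A) : x = 0 :=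
  congrArg (fun t => t.hom.hom x) ((IsZero.iff_id_eq_zero A).mp h)

/-- A copy of the interval module supported in `[a, c)` that is a direct summand of `V`: a
generator at each point and the coordinate function with respect to it. -/
structure Bar (V : WithTop X ⥤ FGModuleCat.{u} K) (a c : WithTop X) where
  vec : ∀ p, V.obj p
  coord : ∀ p, V.obj p →ₗ[K] K
  vec_eq_zero : ∀ p, ¬ (a ≤ p ∧ p < c) → vec p = 0
  coord_eq_zero : ∀ p, ¬ (a ≤ p ∧ p < c) → coord p = 0
  str_vec : ∀ {p q : WithTop X} (h : p ≤ q), a ≤ p → str V h (vec p) = vec q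
  coord_str : ∀ {p q : WithTop X} (h : p ≤ q), q < c → ∀ x, coord q (str V h x) = coord p x
  coord_vec : ∀ p, a ≤ p → p < c → coord p (vec p) = 1

/-- `V` is isomorphic to the interval module supported in `[a, c)`. -/
def IsInterval (V : WithTop X ⥤ FGModuleCat.{u} K) (a c : WithTop X) : Prop :=
  ∃ B : Bar V a c, ∀ p x, B.coord p x • B.vec p = x

namespace Bar

/-- A bar in a direct summand is a bar. -/
def ofRetract {V W : WithTop X ⥤ FGModuleCat.{u} K} {a c : WithTop X} (B : Bar V a c)
    (i : V ⟶ W) (r : W ⟶ V) (hir : i ≫ r = 𝟙 V) : Bar W a c where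
  vec p := comp i p (B.vec p)
  coord p := B.coord p ∘ₗ comp r p
  vec_eq_zero p hp := by rw [B.vec_eq_zero p hp, map_zero]
  coord_eq_zero p hp := by rw [B.coord_eq_zero p hp, LinearMap.zero_comp]
  str_vec h hp := by rw [← comp_str, B.str_vec h hp]
  coord_str h hq x := by
    rw [LinearMap.comp_apply, comp_str, B.coord_str h hq, LinearMap.comp_apply]
  coord_vec p h₁ h₂ := by
    have : comp r p (comp i p (B.vec p)) = B.vec p :=
      congrArg (fun t => comp t p (B.vec p)) hir
    rw [LinearMap.comp_apply, this, B.coord_vec p h₁ h₂]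

/-- The projection of a representation to a bar. -/
def proj {V : WithTop X ⥤ FGModuleCat.{u} K} {a c : WithTop X} (B : Bar V a c) : V ⟶ V :=
  mkHom (fun p => (B.coord p).smulRight (B.vec p)) fun {p q} h x => by
    rw [LinearMap.smulRight_apply, LinearMap.smulRight_apply, map_smul]
    by_cases hp : a ≤ p
    · rw [B.str_vec h hp]
      by_cases hq : q < c
      · rw [B.coord_str h hq]
      · rw [B.vec_eq_zero q fun h => hq h.2, smul_zero, smul_zero]
    · rw [B.vec_eq_zero p fun h => hp h.1, map_zero, smul_zero]
      by_cases hq : q < c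
      · rw [B.coord_str h hq, B.coord_eq_zero p fun h => hp h.1, LinearMap.zero_apply, zero_smul]
      · rw [B.vec_eq_zero q fun h => hq h.2, smul_zero]

theorem comp_proj {V : WithTop X ⥤ FGModuleCat.{u} K} {a c : WithTop X} (B : Bar V a c)
    (p : WithTop X) (x : V.obj p) : comp B.proj p x = B.coord p x • B.vec p := rfl

theorem proj_comp_proj {V : WithTop X ⥤ FGModuleCat.{u} K} {a c : WithTop X} (B : Bar V a c) :
    B.proj ≫ B.proj = B.proj := by
  refine hom_ext_comp fun p x => ?_
  change comp B.proj p (comp B.proj p x) = comp B.proj p x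
  simp only [comp_proj, map_smul]
  by_cases hp : a ≤ p ∧ p < c
  · rw [B.coord_vec p hp.1 hp.2, one_smul]
  · rw [B.vec_eq_zero p hp, smul_zero, smul_zero]

end Bar

/-- A nonzero vector is pushed right for as long as it survives and then pulled back as far left as
possible. A functional that kills everything born earlier splits off the resulting interval. -/
theorem exists_bar {V : WithTop X ⥤ FGModuleCat.{u} K} (htop : IsZero (V.obj ⊤))
    (hV : ¬ IsZero V) : ∃ a c, a < c ∧ Nonempty (Bar V a c) := by
  obtain ⟨p, x, hx⟩ : ∃ p, ∃ x : V.obj p, x ≠ 0 := by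
    by_contra! h
    refine hV (Functor.isZero V fun p => ?_)
    rw [IsZero.iff_id_eq_zero]
    apply FGModuleCat.hom_ext
    exact LinearMap.ext fun x => h p x
  -- `q` is the last point that `x` reaches alive; the right end `c` will be its successor.
  obtain ⟨q, ⟨hpq, hq⟩, hqmax⟩ := Set.exists_max_image {r | ∃ h : p ≤ r, str V h x ≠ 0} id
    (Set.toFinite _) ⟨p, le_rfl, by rwa [str_refl]⟩
  have hqtop : q < ⊤ := by
    rw [lt_top_iff_ne_top]
    rintro rfl
    exact hq (eq_zero_of_isZero htop _)
  obtain ⟨c, hqc, -⟩ := exists_covBy_le_of_lt hqtop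
  set w := str V hpq x with hw
  have hw0 : ∀ r (h : q < r), str V h.le w = 0 := by
    intro r h
    by_contra hne
    rw [hw, str_str] at hne
    exact absurd (hqmax r ⟨hpq.trans h.le, hne⟩) (not_le.mpr h)
  -- `a` is the earliest birth of a preimage `v` of `w`.
  obtain ⟨a, ⟨haq, v, hv⟩, hamin⟩ := Set.exists_min_image
    {r | ∃ h : r ≤ q, w ∈ LinearMap.range (str V h)} id
    (Set.toFinite _) ⟨q, le_rfl, w, str_refl V _ w⟩
  -- The images in `V q` from points below `a` increase with the point, so the image from the
  -- predecessor of `a` contains them all. It misses `w` because `a` is minimal.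
  obtain ⟨U, hwU, hU⟩ : ∃ U : Submodule K (V.obj q), w ∉ U ∧
      ∀ r (h : r < a) (y : V.obj r), str V (h.le.trans haq) y ∈ U := by
    by_cases hmin : IsMin a
    · exact ⟨⊥, hq, fun r h => absurd h hmin.not_lt⟩
    · obtain ⟨s, hs⟩ := not_isMin_iff.mp hmin
      obtain ⟨r, -, hr⟩ := exists_le_covBy_of_lt hs
      refine ⟨LinearMap.range (str V (hr.le.trans haq)), fun h => ?_, fun t ht y => ?_⟩
      · exact absurd (hamin r ⟨_, h⟩) (not_le.mpr hr.lt)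
      · exact ⟨str V (hr.le_of_lt ht) y, str_str V _ _ y⟩
  obtain ⟨g, hgw, hgU⟩ := Submodule.exists_le_ker_of_notMem hwU
  refine ⟨a, c, haq.trans_lt hqc.lt, ⟨{
    vec := fun r => if h : a ≤ r then str V h v else 0
    coord := fun r => if h : r ≤ q then (g w)⁻¹ • (g ∘ₗ str V h) else 0
    vec_eq_zero := ?_
    coord_eq_zero := ?_
    str_vec := ?_
    coord_str := ?_
    coord_vec := ?_ }⟩⟩
  · intro r hr
    by_cases har : a ≤ r
    · have hcr : q < r := hqc.lt.trans_le (not_lt.mp fun h => hr ⟨har, h⟩)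
      rw [dif_pos har, ← str_str V haq hcr.le, hv, hw0 r hcr]
    · rw [dif_neg har]
  · intro r hr
    by_cases hrq : r ≤ q
    · have hra : r < a := not_le.mp fun h => hr ⟨h, hrq.trans_lt hqc.lt⟩
      rw [dif_pos hrq]
      ext y
      have : g (str V hrq y) = 0 := hgU (hU r hra y)
      simp [this]
    · rw [dif_neg hrq]
  · intro r s h har
    rw [dif_pos har, dif_pos (har.trans h), str_str]
  · intro r s h hs y
    have hsq : s ≤ q := hqc.le_of_lt hs
    rw [dif_pos hsq, dif_pos (h.trans hsq)]
    simp [str_str]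
  · intro r har hrc
    rw [dif_pos har, dif_pos (hqc.le_of_lt hrc)]
    simp [str_str, hv, inv_mul_cancel₀ hgw]

/-- Splitting `e` and `𝟙 - e` writes `V` as a biproduct, one factor of which must vanish. -/
theorem eq_zero_or_eq_id_of_indecomposable {C : Type*} [Category* C] [Abelian C]
    {V : C} (hV : Indecomposable V) (e : V ⟶ V) (he : e ≫ e = e) : e = 0 ∨ e = 𝟙 V := by
  obtain ⟨Y, i, r, hir, hri⟩ := IsIdempotentComplete.idempotents_split V e he
  obtain ⟨Y', i', r', hir', hri'⟩ := IsIdempotentComplete.idempotents_split V (𝟙 V - e)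
    (Idempotents.idem_of_id_sub_idem e he)
  have h₁ : i ≫ r' = 0 := by
    have : i ≫ (r ≫ i) ≫ (r' ≫ i') ≫ r' = i ≫ r' := by
      simp only [Category.assoc, hir', Category.comp_id, reassoc_of% hir]
    rw [← this, hri, hri']
    simp [reassoc_of% he]
  have h₂ : i' ≫ r = 0 := by
    have : i' ≫ (r' ≫ i') ≫ (r ≫ i) ≫ r = i' ≫ r := by
      simp only [Category.assoc, hir, Category.comp_id, reassoc_of% hir']
    rw [← this, hri, hri']
    simp [reassoc_of% he]
  rcases hV.2 Y Y' {
      hom := biprod.lift r r'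
      inv := biprod.desc i i'
      hom_inv_id := by rw [biprod.lift_desc, hri, hri']; abel
      inv_hom_id := by
        apply biprod.hom_ext' <;> apply biprod.hom_ext <;> simp [hir, hir', h₁, h₂] } with h | h
  · left
    rw [← hri, h.eq_zero_of_src i, comp_zero]
  · right
    rw [h.eq_zero_of_src i', comp_zero] at hri'
    exact (sub_eq_zero.mp hri'.symm).symm

/-- The projection to a bar is idempotent and nonzero, since its generator at `a` has coordinate
`1`; hence it is the identity. -/
theorem exists_isInterval {I : ChainMod K X} (hI : IsIndec I) :
    ∃ a c, a < c ∧ IsInterval I.obj a c := by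
  obtain ⟨a, c, hac, ⟨B⟩⟩ := exists_bar I.property hI.1
  refine ⟨a, c, hac, B, fun p x => ?_⟩
  rcases eq_zero_or_eq_id_of_indecomposable hI B.proj B.proj_comp_proj with h | h
  · have h1 : B.coord a (comp B.proj a (B.vec a)) = 1 := by
      rw [B.comp_proj, B.coord_vec a le_rfl hac, one_smul, B.coord_vec a le_rfl hac]
    have h0 : comp B.proj a (B.vec a) = 0 := congrArg (fun t => comp t a (B.vec a)) h
    rw [h0, map_zero] at h1
    exact absurd h1 zero_ne_one
  · exact congrArg (fun t => comp t p x) h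

/-- A family of bars forming a direct sum decomposition. -/
structure BarBasis (V : WithTop X ⥤ FGModuleCat.{u} K) {ι : Type} [Fintype ι]
    (a c : ι → WithTop X) where
  bar : ∀ i, Bar V (a i) (c i)
  coord_vec_of_ne : ∀ {i j}, i ≠ j → ∀ p, (bar i).coord p ((bar j).vec p) = 0
  sum_smul : ∀ p x, ∑ i, (bar i).coord p x • (bar i).vec p = x

theorem exists_retracts {V : WithTop X ⥤ FGModuleCat.{u} K} {ι : Type} [Fintype ι]
    {F : ι → WithTop X ⥤ FGModuleCat.{u} K} (e : V ≅ ⨁ F) :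
    ∃ (s : ∀ i, F i ⟶ V) (r : ∀ i, V ⟶ F i), (∀ i, s i ≫ r i = 𝟙 (F i)) ∧
      (∀ i j, i ≠ j → s i ≫ r j = 0) ∧
      ∀ p x, ∑ i, comp (s i) p (comp (r i) p x) = x := by
  refine ⟨fun i => biproduct.ι F i ≫ e.inv, fun i => e.hom ≫ biproduct.π F i, fun i => by simp,
    fun i j hij => by simp [biproduct.ι_π_ne F hij], fun p x => ?_⟩
  have htot : ∑ i, (e.hom ≫ biproduct.π F i) ≫ biproduct.ι F i ≫ e.inv = 𝟙 V := by
    have : ∀ i, (e.hom ≫ biproduct.π F i) ≫ biproduct.ι F i ≫ e.inv =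
        e.hom ≫ (biproduct.π F i ≫ biproduct.ι F i) ≫ e.inv := fun i => by simp
    simp only [this]
    rw [← Preadditive.comp_sum, ← Preadditive.sum_comp, biproduct.total]
    simp
  let L : (V ⟶ V) →+ V.obj p :=
    { toFun := fun t => comp t p x, map_zero' := rfl, map_add' := fun _ _ => rfl }
  exact (map_sum L _ _).symm.trans (congrArg L htot)

theorem exists_barBasis {V : WithTop X ⥤ FGModuleCat.{u} K} {ι : Type} [Fintype ι]
    {F : ι → WithTop X ⥤ FGModuleCat.{u} K} (e : V ≅ ⨁ F) {a c : ι → WithTop X}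
    (h : ∀ i, IsInterval (F i) (a i) (c i)) : Nonempty (BarBasis V a c) := by
  choose B hB using h
  obtain ⟨s, r, hsr, hsr₀, hsum⟩ := exists_retracts e
  refine ⟨⟨fun i => (B i).ofRetract _ _ (hsr i), ?_, ?_⟩⟩
  · intro i j hij p
    have := congrArg (fun t => comp t p ((B j).vec p)) (hsr₀ j i hij.symm)
    exact (congrArg ((B i).coord p) this).trans (map_zero _)
  · intro p x
    refine (Finset.sum_congr rfl fun i _ => ?_).trans (hsum p x)
    change (B i).coord p (comp (r i) p x) • comp (s i) p ((B i).vec p) = _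
    rw [← map_smul, hB]

end

section

/-! ### Matchings from matrices and partial matchings -/

/-- If the product of two matrices is unitriangular on a set `S` of indices with respect to some
order, and the terms on and above the diagonal come from adjacent pairs, then `S` can be matched
along adjacent pairs. -/
theorem exists_injective_of_unitriangular {K : Type*} [Field K] {ι κ : Type} [Fintype κ]
    (f : ι → κ → K) (g : κ → ι → K) (key : ι → ℝ) (adj : ι → κ → Prop)
    [Finite ι] (S : Set ι)
    (hone : ∀ i ∈ S, ∑ j, f i j * g j i = 1)
    (hzero : ∀ i ∈ S, ∀ i' ∈ S, i ≠ i' → key i ≤ key i' → ∑ j, f i j * g j i' = 0)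
    (hadj : ∀ i ∈ S, ∀ i' ∈ S, key i ≤ key i' → ∀ j, f i j ≠ 0 → g j i' ≠ 0 →
      adj i j ∨ adj i' j) :
    ∃ m : S → κ, Function.Injective m ∧ ∀ i : S, adj i (m i) := by
  classical
  -- Hall's condition for a subset `A` with neighbourhood `T` follows from an injective linear map
  -- `K^A → K^T`.
  obtain ⟨m, hm, hmadj⟩ := (Finset.all_card_le_biUnion_card_iff_exists_injective
    fun i : S => Finset.univ.filter fun j => adj i j).mp fun A => by
      set T := A.biUnion fun i : S => Finset.univ.filter fun j => adj i j with hT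
      -- By `hadj`, a nonzero term has its middle index adjacent to `i` or `i'`, so restricting to
      -- `T` loses nothing.
      have hsum : ∀ i ∈ A, ∀ i' ∈ A, key i ≤ key i' →
          ∑ j ∈ T, f i j * g j i' = ∑ j, f i j * g j i' := by
        intro i hi i' hi' hk
        refine Finset.sum_subset (Finset.subset_univ _) fun j _ hj => ?_
        by_contra hne
        have hne' := mul_ne_zero_iff.mp hne
        refine hj ?_
        rw [hT, Finset.mem_biUnion]
        rcases hadj i i.2 i' i'.2 hk j hne'.1 hne'.2 with h | h
        · exact ⟨i, hi, by simpa using h⟩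
        · exact ⟨i', hi', by simpa using h⟩
      let L : (A → K) →ₗ[K] (T → K) :=
        LinearMap.pi fun j => ∑ i : A, f i j • LinearMap.proj i
      have hL : ∀ v j, L v j = ∑ i : A, f i j * v i := by
        intro v j
        simp [L]
      have hinj : Function.Injective L := by
        rw [← LinearMap.ker_eq_bot, LinearMap.ker_eq_bot']
        intro v hv
        by_contra hne
        obtain ⟨i₀, hi₀⟩ := Function.ne_iff.mp hne
        -- The products are known only for `key i ≤ key i'`, so `i'` has the largest key in the
        -- support of `v`. Pairing `L v = 0` with column `i'` of `g` then leaves `v i'` alone.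
        obtain ⟨i', hi', hmax⟩ := Set.exists_max_image {i : A | v i ≠ 0} (fun i => key i)
          (Set.toFinite _) ⟨i₀, hi₀⟩
        refine hi' ?_
        have h0 : ∑ j : T, L v j * g j i' = 0 := by simp [hv]
        simp only [hL, Finset.sum_mul] at h0
        rw [Finset.sum_comm, Finset.sum_eq_single i'] at h0
        · have h1 := hsum i' i'.2 i' i'.2 le_rfl
          rw [hone i' i'.1.2, ← Finset.sum_coe_sort] at h1
          have h2 : ∑ j : T, f i' j * v i' * g j i' = v i' * ∑ j : T, f i' j * g j i' := by
            rw [Finset.mul_sum]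
            exact Finset.sum_congr rfl fun j _ => by ring
          rw [h2, h1, mul_one] at h0
          exact h0
        · intro i _ hii'
          by_cases hvi : v i = 0
          · simp [hvi]
          · have hk := hmax i hvi
            have h1 := hsum i i.2 i' i'.2 hk
            rw [hzero i i.1.2 i' i'.1.2 (fun h => hii' (Subtype.ext (Subtype.ext h))) hk,
              ← Finset.sum_coe_sort] at h1
            have h2 : ∑ j : T, f i j * v i * g j i' = v i * ∑ j : T, f i j * g j i' := by
              rw [Finset.mul_sum]
              exact Finset.sum_congr rfl fun j _ => by ring
            rw [h2, h1, mul_zero]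
        · exact fun h => absurd (Finset.mem_univ _) h
      have := LinearMap.finrank_le_finrank_of_injective hinj
      simpa using this
  exact ⟨m, hm, fun i => by simpa using hmadj i⟩

/-- The points reached by alternately following two partial maps, starting from the points of the
domain of the first that are not in the range of the second. -/
inductive Alternating {ι κ : Type} {S : Set ι} {T : Set κ} (f : S → κ) (g : T → ι) : ι → Prop
  | start (s : S) (h : ∀ t, g t ≠ s) : Alternating f g s
  | step (s : S) (h : Alternating f g s) (ht : f s ∈ T) : Alternating f g (g ⟨f s, ht⟩)

/-- If each of two sets `S`, `T` of vertices on the two sides of a bipartite graph can be matched,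
then some matching covers both. -/
theorem exists_matching_covering {ι κ : Type} [Finite ι] [Finite κ] {adj : ι → κ → Prop}
    {S : Set ι} {T : Set κ}
    (hS : ∃ f : S → κ, Function.Injective f ∧ ∀ s : S, adj s (f s))
    (hT : ∃ g : T → ι, Function.Injective g ∧ ∀ t : T, adj (g t) t) :
    ∃ E : Finset (ι × κ), Set.InjOn Prod.fst (E : Set (ι × κ)) ∧
      Set.InjOn Prod.snd (E : Set (ι × κ)) ∧ (∀ e ∈ E, adj e.1 e.2) ∧
      (∀ i ∈ S, ∃ e ∈ E, e.1 = i) ∧ ∀ j ∈ T, ∃ e ∈ E, e.2 = j := by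
  classical
  obtain ⟨f, hf, hfadj⟩ := hS
  obtain ⟨g, hg, hgadj⟩ := hT
  -- Use `f` along the alternating paths and `g` away from them, as in the Cantor–Bernstein
  -- argument.
  let E : Set (ι × κ) := {e | (∃ s : S, Alternating f g s ∧ e = (s.1, f s)) ∨
    ∃ t : T, ¬ Alternating f g (g t) ∧ e = (g t, t.1)}
  have hE : ∀ e, e ∈ (Set.toFinite E).toFinset ↔ e ∈ E := fun e => by simp
  have hdisj : ∀ (s : S) (t : T), Alternating f g s → ¬ Alternating f g (g t) → f s ≠ t := by
    rintro s t hs ht h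
    have hst : f s ∈ T := h ▸ t.2
    rw [show t = ⟨f s, hst⟩ from Subtype.ext h.symm] at ht
    exact ht (Alternating.step s hs hst)
  refine ⟨(Set.toFinite E).toFinset, ?_, ?_, ?_, ?_, ?_⟩
  · rw [Set.Finite.coe_toFinset]
    rintro _ (⟨s, hs, rfl⟩ | ⟨t, ht, rfl⟩) _ (⟨s', hs', rfl⟩ | ⟨t', ht', rfl⟩) h
    · obtain rfl : s = s' := Subtype.ext h
      rfl
    · exact absurd (show Alternating f g (g t') from (show s.1 = g t' from h) ▸ hs) ht'
    · exact absurd (show Alternating f g (g t) from (show g t = s'.1 from h) ▸ hs') ht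
    · obtain rfl : t = t' := hg h
      rfl
  · rw [Set.Finite.coe_toFinset]
    rintro _ (⟨s, hs, rfl⟩ | ⟨t, ht, rfl⟩) _ (⟨s', hs', rfl⟩ | ⟨t', ht', rfl⟩) h
    · obtain rfl : s = s' := hf h
      rfl
    · exact absurd h (hdisj s t' hs ht')
    · exact absurd h.symm (hdisj s' t hs' ht)
    · obtain rfl : t = t' := Subtype.ext h
      rfl
  · intro e he
    rcases (hE e).mp he with ⟨s, -, rfl⟩ | ⟨t, -, rfl⟩
    exacts [hfadj s, hgadj t]
  · intro i hi
    by_cases ha : Alternating f g i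
    · exact ⟨(i, f ⟨i, hi⟩), (hE _).mpr (Or.inl ⟨⟨i, hi⟩, ha, rfl⟩), rfl⟩
    · obtain ⟨t, rfl⟩ : ∃ t, g t = i := by
        by_contra! h
        exact ha (Alternating.start ⟨i, hi⟩ h)
      exact ⟨(g t, t), (hE _).mpr (Or.inr ⟨t, ha, rfl⟩), rfl⟩
  · intro j hj
    -- If `g j` lies on an alternating path, it is not a starting point, being in the range of `g`.
    -- So it was reached by a step from some `s` with `f s = j`, and the edge of `s` covers `j`.
    by_cases ha : Alternating f g (g ⟨j, hj⟩)
    · generalize hi : g ⟨j, hj⟩ = i at ha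
      cases ha with
      | start s h => exact absurd hi (h _)
      | step s h ht =>
        exact ⟨(s.1, f s), (hE _).mpr (Or.inl ⟨s, h, rfl⟩), (congrArg Subtype.val (hg hi)).symm⟩
    · exact ⟨(g ⟨j, hj⟩, j), (hE _).mpr (Or.inr ⟨⟨j, hj⟩, ha, rfl⟩), rfl⟩

/-! ### Interleavings in coordinates -/

variable {K : Type u} [Field K] {X : Finset ℝ} {Λ : Translation X} {M N : ChainMod K X}

/-- The matrix coefficient of a morphism `M ⟶ N Λ` with respect to bars of `M` and `N`. -/
def barCoeff (φ : M ⟶ (shift K Λ).obj N) {a c a' c' : WithTop X} (B : Bar M.obj a c)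
    (B' : Bar N.obj a' c') : K :=
  B'.coord (Λ a) (comp φ.hom a (B.vec a))

/-- By naturality the coefficient read off at `a` is also the coefficient at later points, until the
target bar dies. -/
theorem coord_comp_vec (φ : M ⟶ (shift K Λ).obj N) {a c a' c' : WithTop X} (B : Bar M.obj a c)
    (B' : Bar N.obj a' c') {p : WithTop X} (hp : a ≤ p) (hp' : Λ p < c') :
    B'.coord (Λ p) (comp φ.hom p (B.vec p)) = barCoeff φ B B' := by
  rw [← B.str_vec hp le_rfl, comp_str φ.hom hp]
  exact B'.coord_str (Λ.toHom.monotone hp) hp' _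

theorem le_of_barCoeff_ne_zero {φ : M ⟶ (shift K Λ).obj N} {a c a' c' : WithTop X}
    {B : Bar M.obj a c} {B' : Bar N.obj a' c'} (h : barCoeff φ B B' ≠ 0) (hac : a ≤ c) :
    a' ≤ Λ a ∧ c' ≤ Λ c := by
  constructor
  · by_contra h'
    refine h ?_
    rw [barCoeff, B'.coord_eq_zero _ fun h => h' h.1]
    rfl
  · by_contra h'
    refine h ?_
    rw [← coord_comp_vec φ B B' hac (not_le.mp h'), B.vec_eq_zero c fun h => lt_irrefl _ h.2,
      map_zero]
    exact map_zero (B'.coord (Λ c))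

/-- The intervals `[a, c)` and `[a', c')` differ by at most `Λ`. -/
def Close (Λ : Translation X) (a c a' c' : WithTop X) : Prop :=
  a' ≤ Λ a ∧ a ≤ Λ a' ∧ c' ≤ Λ c ∧ c ≤ Λ c'

theorem Close.symm {a c a' c' : WithTop X} (h : Close Λ a c a' c') : Close Λ a' c' a c :=
  ⟨h.2.1, h.1, h.2.2.2, h.2.2.1⟩

/-- If the middle interval is far from the first, then it starts more than `ε` before it or ends
more than `ε` before it. The inequality of the sums then supplies the two missing bounds for the
second interval. -/
theorem close_or_close {a c a₁ c₁ a' c' ε : ℝ} (h : a + c ≤ a₁ + c₁) (h₁ : a' ≤ a + ε)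
    (h₂ : c' ≤ c + ε) (h₃ : a₁ ≤ a' + ε) (h₄ : c₁ ≤ c' + ε) :
    (a' ≤ a + ε ∧ a ≤ a' + ε ∧ c' ≤ c + ε ∧ c ≤ c' + ε) ∨
      (a' ≤ a₁ + ε ∧ a₁ ≤ a' + ε ∧ c' ≤ c₁ + ε ∧ c₁ ≤ c' + ε) := by
  by_cases ha : a ≤ a' + ε
  · by_cases hc : c ≤ c' + ε
    · exact Or.inl ⟨h₁, ha, h₂, hc⟩
    · exact Or.inr ⟨by linarith, h₃, by linarith, h₄⟩
  · exact Or.inr ⟨by linarith, h₃, by linarith, h₄⟩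

/-- If `M → M Λ Λ` factors through `N`, then the bars of `M` on which it does not vanish are
injectively matched with bars of `N` that differ from them by at most `Λ`. -/
theorem exists_injective_close {b ε : ℝ}
    (hΛ : ∀ p q, q ≤ Λ p ↔ pos X b q ≤ pos X b p + ε)
    (φ : M ⟶ (shift K Λ).obj N) (ψ : N ⟶ (shift K Λ).obj M)
    (h : φ ≫ (shift K Λ).map ψ = toShiftShift M Λ Λ)
    {ι κ : Type} [Fintype ι] [Fintype κ] {a c : ι → WithTop X} {a' c' : κ → WithTop X}
    (B : BarBasis M.obj a c) (B' : BarBasis N.obj a' c') (hac' : ∀ j, a' j ≤ c' j) :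
    ∃ m : {i | Λ (Λ (a i)) < c i} → κ, Function.Injective m ∧
      ∀ i : {i | Λ (Λ (a i)) < c i}, Close Λ (a i) (c i) (a' (m i)) (c' (m i)) := by
  have hle : ∀ i ∈ {i | Λ (Λ (a i)) < c i}, a i ≤ c i := fun i hi =>
    ((Λ.le_apply _).trans (Λ.le_apply _)).trans (le_of_lt hi)
  have hmono : ∀ {p q}, pos X b p ≤ pos X b q → Λ p ≤ Λ q := fun {p q} hpq =>
    (hΛ _ _).mpr (((hΛ p _).mp le_rfl).trans (by linarith))
  -- The order by `a + c` ensures that bar `i'` has not yet died at `Λ (Λ (a i))`: either it starts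
  -- no earlier than bar `i` and is long itself, or it starts no later and hence ends no earlier.
  have hlt : ∀ i ∈ {i | Λ (Λ (a i)) < c i}, ∀ i' ∈ {i | Λ (Λ (a i)) < c i},
      pos X b (a i) + pos X b (c i) ≤ pos X b (a i') + pos X b (c i') →
      Λ (Λ (a i)) < c i' := by
    intro i hi i' hi' hk
    rcases le_total (pos X b (a i)) (pos X b (a i')) with h' | h'
    · exact (Λ.toHom.monotone (hmono h')).trans_lt hi'
    · have hi : Λ (Λ (a i)) < c i := hi
      rw [← not_le, hΛ, not_le] at hi ⊢
      linarith
  have hcomp : ∀ i ∈ {i | Λ (Λ (a i)) < c i}, ∀ i' ∈ {i | Λ (Λ (a i)) < c i},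
      pos X b (a i) + pos X b (c i) ≤ pos X b (a i') + pos X b (c i') →
      ∑ j, barCoeff φ (B.bar i) (B'.bar j) * barCoeff ψ (B'.bar j) (B.bar i') =
        (B.bar i').coord (Λ (Λ (a i))) ((B.bar i).vec (Λ (Λ (a i)))) := by
    intro i hi i' hi' hk
    have h₁ : comp ψ.hom (Λ (a i)) (comp φ.hom (a i) ((B.bar i).vec (a i))) =
        (B.bar i).vec (Λ (Λ (a i))) := by
      rw [← (B.bar i).str_vec ((Λ.le_apply _).trans (Λ.le_apply _)) le_rfl]
      exact congrArg (fun t => comp t.hom (a i) ((B.bar i).vec (a i))) h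
    rw [← h₁, ← B'.sum_smul (Λ (a i)) (comp φ.hom (a i) ((B.bar i).vec (a i))), map_sum]
    refine (Finset.sum_congr rfl fun j _ => ?_).trans (map_sum ((B.bar i').coord _) _ _).symm
    rw [map_smul]
    refine Eq.trans ?_ (map_smul ((B.bar i').coord _) _ _).symm
    rw [smul_eq_mul]
    -- A nonzero first coefficient forces `a' j ≤ Λ (a i)`, which allows the second one to be read
    -- off at `Λ (a i)`.
    by_cases h0 : barCoeff φ (B.bar i) (B'.bar j) = 0
    · rw [h0, zero_mul]
      exact (mul_eq_zero_of_left h0 _).symm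
    · congr 1
      exact (coord_comp_vec ψ (B'.bar j) (B.bar i') (le_of_barCoeff_ne_zero h0 (hle i hi)).1
        (hlt i hi i' hi' hk)).symm
  refine exists_injective_of_unitriangular (fun i j => barCoeff φ (B.bar i) (B'.bar j))
    (fun j i => barCoeff ψ (B'.bar j) (B.bar i)) (fun i => pos X b (a i) + pos X b (c i))
    (fun i j => Close Λ (a i) (c i) (a' j) (c' j)) _ ?_ ?_ ?_
  · intro i hi
    rw [hcomp i hi i hi le_rfl,
      (B.bar i).coord_vec _ ((Λ.le_apply _).trans (Λ.le_apply _)) hi]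
  · intro i hi i' hi' hne hk
    rw [hcomp i hi i' hi' hk, B.coord_vec_of_ne hne.symm]
  · intro i hi i' hi' hk j hφ hψ
    obtain ⟨h₁, h₂⟩ := le_of_barCoeff_ne_zero hφ (hle i hi)
    obtain ⟨h₃, h₄⟩ := le_of_barCoeff_ne_zero hψ (hac' j)
    simp only [Close, hΛ] at h₁ h₂ h₃ h₄ ⊢
    exact close_or_close hk h₁ h₂ h₃ h₄

/-- An interleaving of two direct sums of intervals induces a matching of the intervals. -/
theorem exists_matching_of_interleaved {b ε : ℝ}
    (hΛ : ∀ p q, q ≤ Λ p ↔ pos X b q ≤ pos X b p + ε) (h : Interleaved Λ Λ M N)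
    {ι κ : Type} [Fintype ι] [Fintype κ] {a c : ι → WithTop X} {a' c' : κ → WithTop X}
    (B : BarBasis M.obj a c) (B' : BarBasis N.obj a' c') (hac : ∀ i, a i ≤ c i)
    (hac' : ∀ j, a' j ≤ c' j) :
    ∃ E : Finset (ι × κ), Set.InjOn Prod.fst (E : Set (ι × κ)) ∧
      Set.InjOn Prod.snd (E : Set (ι × κ)) ∧
      (∀ e ∈ E, Close Λ (a e.1) (c e.1) (a' e.2) (c' e.2)) ∧
      (∀ i, (∀ e ∈ E, e.1 ≠ i) → c i ≤ Λ (Λ (a i))) ∧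
      ∀ j, (∀ e ∈ E, e.2 ≠ j) → c' j ≤ Λ (Λ (a' j)) := by
  obtain ⟨φ, ψ, h₁, h₂⟩ := h
  obtain ⟨m, hm, hmc⟩ := exists_injective_close hΛ φ ψ h₁ B B' hac'
  obtain ⟨n, hn, hnc⟩ := exists_injective_close hΛ ψ φ h₂ B' B hac
  obtain ⟨E, hE₁, hE₂, hE₃, hE₄, hE₅⟩ := exists_matching_covering
    (adj := fun i j => Close Λ (a i) (c i) (a' j) (c' j))
    ⟨m, hm, hmc⟩ ⟨n, hn, fun j => (hnc j).symm⟩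
  refine ⟨E, hE₁, hE₂, hE₃, fun i hi => ?_, fun j hj => ?_⟩
  · by_contra hlt
    obtain ⟨e, he, hei⟩ := hE₄ i (not_le.mp hlt)
    exact hi e he hei
  · by_contra hlt
    obtain ⟨e, he, hej⟩ := hE₅ j (not_le.mp hlt)
    exact hj e he hej

end

section

variable {K : Type u} [Field K] {X : Finset ℝ}

/-! ### Interleavings in terms of linear maps -/

theorem Translation.mono (Λ : Translation X) {p q : WithTop X} (h : p ≤ q) : Λ p ≤ Λ q :=
  Λ.toHom.monotone h

theorem Translation.le_comp (Γ Λ : Translation X) (p : WithTop X) : p ≤ Γ (Λ p) :=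
  (Λ.le_apply p).trans (Γ.le_apply _)

theorem interleaved_iff {Γ Λ : Translation X} {M N : ChainMod K X} :
    Interleaved Γ Λ M N ↔
      ∃ (φ : ∀ p, M.obj.obj p →ₗ[K] N.obj.obj (Λ p)) (ψ : ∀ p, N.obj.obj p →ₗ[K] M.obj.obj (Γ p)),
        (∀ {p q} (h : p ≤ q) x, φ q (str M.obj h x) = str N.obj (Λ.mono h) (φ p x)) ∧
        (∀ {p q} (h : p ≤ q) x, ψ q (str N.obj h x) = str M.obj (Γ.mono h) (ψ p x)) ∧
        (∀ p x, ψ (Λ p) (φ p x) = str M.obj (Γ.le_comp Λ p) x) ∧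
        ∀ p x, φ (Γ p) (ψ p x) = str N.obj (Λ.le_comp Γ p) x := by
  constructor
  · rintro ⟨φ, ψ, h₁, h₂⟩
    exact ⟨fun p => comp φ.hom p, fun p => comp ψ.hom p, fun h x => comp_str φ.hom h x,
      fun h x => comp_str ψ.hom h x, fun p x => congrArg (fun t => comp t.hom p x) h₁,
      fun p x => congrArg (fun t => comp t.hom p x) h₂⟩
  · rintro ⟨φ, ψ, hφ, hψ, h₁, h₂⟩
    refine ⟨ObjectProperty.homMk (mkHom φ fun h x => hφ h x),
      ObjectProperty.homMk (mkHom ψ fun h x => hψ h x), ?_, ?_⟩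
    · exact ObjectProperty.hom_ext _ (hom_ext_comp h₁)
    · exact ObjectProperty.hom_ext _ (hom_ext_comp h₂)

theorem Interleaved.mono {Γ Λ Γ' Λ' : Translation X} {M N : ChainMod K X}
    (h : Interleaved Γ Λ M N) (hΓ : ∀ p, Γ p ≤ Γ' p) (hΛ : ∀ p, Λ p ≤ Λ' p) :
    Interleaved Γ' Λ' M N := by
  rw [interleaved_iff] at h ⊢
  obtain ⟨φ, ψ, hφ, hψ, h₁, h₂⟩ := h
  refine ⟨fun p => str N.obj (hΛ p) ∘ₗ φ p, fun p => str M.obj (hΓ p) ∘ₗ ψ p, ?_, ?_, ?_, ?_⟩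
  · intro p q h x
    simp only [LinearMap.comp_apply, hφ h, str_str]
  · intro p q h x
    simp only [LinearMap.comp_apply, hψ h, str_str]
  · intro p x
    simp only [LinearMap.comp_apply, hψ, h₁, str_str]
  · intro p x
    simp only [LinearMap.comp_apply, hφ, h₂, str_str]

theorem interleaved_topTranslation (M N : ChainMod K X) :
    Interleaved (topTranslation X) (topTranslation X) M N := by
  rw [interleaved_iff]
  exact ⟨0, 0, fun _ _ => (eq_zero_of_isZero N.property _).trans
    (eq_zero_of_isZero N.property _).symm, fun _ _ => (eq_zero_of_isZero M.property _).trans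
    (eq_zero_of_isZero M.property _).symm, fun _ _ => (eq_zero_of_isZero M.property _).trans
    (eq_zero_of_isZero M.property _).symm, fun _ _ => (eq_zero_of_isZero N.property _).trans
    (eq_zero_of_isZero N.property _).symm⟩

variable {b : ℝ}

/-- The infimum is attained, and the attaining translations can be enlarged to the maximal one. -/
theorem interleavingDist_le_iff (hb : 0 < b) {ε : ℝ} (hε : 0 ≤ ε) {M N : ChainMod K X} :
    interleavingDist b M N ≤ ε ↔
      Interleaved (maxTranslation X b hb ε hε) (maxTranslation X b hb ε hε) M N := by
  constructor
  · intro h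
    obtain ⟨Γ, Λ, hΓ, hΛ, hi⟩ := exists_of_sInf_le ⟨_, _, interleaved_topTranslation M N⟩ h
    exact hi.mono (Γ.le_maxTranslation hb hε hΓ) (Λ.le_maxTranslation hb hε hΛ)
  · intro h
    exact sInf_le_of_exists hb
      ⟨_, _, height_maxTranslation_le hb hε, height_maxTranslation_le hb hε, h⟩

theorem interleavingDist_nonneg (hb : 0 < b) (M N : ChainMod K X) :
    0 ≤ interleavingDist b M N :=
  Real.sInf_nonneg fun _ ⟨Γ, _, h, _⟩ => (Γ.height_nonneg hb).trans h

/-- The canonical morphism `I → I Λ Γ` is one of the morphisms forced to vanish, and the structure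
map here factors through it. -/
theorem str_eq_zero_of_width_le (hb : 0 < b) {ε : ℝ} (hε : 0 ≤ ε) {I : ChainMod K X}
    (h : width b I ≤ ε) (p : WithTop X) (x : I.obj.obj p) :
    str I.obj ((maxTranslation X b hb ε hε).le_comp (maxTranslation X b hb ε hε) p) x = 0 := by
  obtain ⟨Λ, Γ, hΛ, hΓ, h0⟩ := exists_of_sInf_le
    (P := fun Λ Γ : Translation X =>
      ∀ f : I.obj ⟶ ((shift K Γ).obj ((shift K Λ).obj I)).obj, f = 0)
    ⟨topTranslation X, topTranslation X, fun f => hom_ext_comp fun p x =>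
      (eq_zero_of_isZero I.property _).trans (eq_zero_of_isZero I.property _).symm⟩ h
  have h1 : str I.obj (Λ.le_comp Γ p) x = 0 :=
    congrArg (fun t => comp t p x) (h0 (toShiftShift I Λ Γ).hom)
  have hle : Λ (Γ p) ≤ maxTranslation X b hb ε hε (maxTranslation X b hb ε hε p) :=
    (Λ.mono (Γ.le_maxTranslation hb hε hΓ p)).trans (Λ.le_maxTranslation hb hε hΛ _)
  rw [← str_str I.obj (Λ.le_comp Γ p) hle, h1, map_zero]

/-! ### Distance and width of intervals -/

theorem eq_zero_of_isInterval {V : WithTop X ⥤ FGModuleCat.{u} K} {a c p : WithTop X}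
    (h : IsInterval V a c) (hp : ¬ (a ≤ p ∧ p < c)) (x : V.obj p) : x = 0 := by
  obtain ⟨B, hB⟩ := h
  rw [← hB p x, B.vec_eq_zero p hp, smul_zero]

theorem width_le_of_isInterval (hb : 0 < b) {ε : ℝ} (hε : 0 ≤ ε) {I : ChainMod K X}
    {a c : WithTop X} (h : IsInterval I.obj a c)
    (hac : c ≤ maxTranslation X b hb ε hε (maxTranslation X b hb ε hε a)) : width b I ≤ ε := by
  refine sInf_le_of_exists hb
    ⟨_, _, height_maxTranslation_le hb hε, height_maxTranslation_le hb hε, fun f => ?_⟩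
  refine hom_ext_comp fun p x => ?_
  by_cases hp : a ≤ p
  · refine (eq_zero_of_isInterval h (fun h' => ?_) _).trans
      (eq_zero_of_isInterval h (fun h' => ?_) _).symm <;>
    exact absurd h'.2 (not_lt.mpr (hac.trans (Translation.mono _ (Translation.mono _ hp))))
  · rw [eq_zero_of_isInterval h (fun h' => hp h'.1) x, map_zero, map_zero]

theorem coord_str_smul_vec {Λ : Translation X} {V W : WithTop X ⥤ FGModuleCat.{u} K}
    {a c a' c' : WithTop X} (B : Bar V a c) (B' : Bar W a' c') (ha : a' ≤ Λ a) (hc : c' ≤ Λ c)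
    {p q : WithTop X} (h : p ≤ q) (x : V.obj p) :
    B.coord q (str V h x) • B'.vec (Λ q) = str W (Λ.mono h) (B.coord p x • B'.vec (Λ p)) := by
  by_cases hp : a ≤ p
  · rw [map_smul, B'.str_vec _ (ha.trans (Λ.mono hp))]
    by_cases hq : q < c
    · rw [B.coord_str h hq]
    · rw [B'.vec_eq_zero _ fun h' => absurd h'.2 (not_lt.mpr (hc.trans (Λ.mono (not_lt.mp hq)))),
        smul_zero, smul_zero]
  · rw [B.coord_eq_zero p fun h' => hp h'.1, LinearMap.zero_apply, zero_smul, map_zero]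
    by_cases hq : q < c
    · rw [B.coord_str h hq, B.coord_eq_zero p fun h' => hp h'.1, LinearMap.zero_apply, zero_smul]
    · rw [B.coord_eq_zero q fun h' => hq h'.2, LinearMap.zero_apply, zero_smul]

/-- The middle bar is alive at `Λ p` whenever it matters: if `c' ≤ Λ p`, then `c ≤ Λ c' ≤ Λ (Λ p)`
and the target vanishes anyway. -/
theorem coord_smul_vec_smul_vec {Λ : Translation X} {V W : WithTop X ⥤ FGModuleCat.{u} K}
    {a c a' c' : WithTop X} (B : Bar V a c) (hB : ∀ p x, B.coord p x • B.vec p = x)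
    (B' : Bar W a' c')
    (ha : a' ≤ Λ a) (hc : c ≤ Λ c') (p : WithTop X) (x : V.obj p) :
    B'.coord (Λ p) (B.coord p x • B'.vec (Λ p)) • B.vec (Λ (Λ p)) = str V (Λ.le_comp Λ p) x := by
  by_cases hp : a ≤ p
  · conv_rhs => rw [← hB p x, map_smul, B.str_vec _ hp]
    by_cases hq : Λ (Λ p) < c
    · rw [map_smul, B'.coord_vec _ (ha.trans (Λ.mono hp)), smul_eq_mul, mul_one]
      by_contra h'
      exact absurd hq (not_lt.mpr (hc.trans (Λ.mono (not_lt.mp h'))))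
    · rw [B.vec_eq_zero _ fun h' => hq h'.2, smul_zero, smul_zero]
  · rw [eq_zero_of_isInterval ⟨B, hB⟩ (fun h' => hp h'.1) x]
    simp only [map_zero, zero_smul]

theorem interleaved_of_close {Λ : Translation X} {I J : ChainMod K X} {a c a' c' : WithTop X}
    (hI : IsInterval I.obj a c) (hJ : IsInterval J.obj a' c') (h : Close Λ a c a' c') :
    Interleaved Λ Λ I J := by
  obtain ⟨B, hB⟩ := hI
  obtain ⟨B', hB'⟩ := hJ
  obtain ⟨h₁, h₂, h₃, h₄⟩ := h
  rw [interleaved_iff]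
  exact ⟨fun p => (B.coord p).smulRight (B'.vec (Λ p)), fun p => (B'.coord p).smulRight (B.vec (Λ p)),
    fun h x => coord_str_smul_vec B B' h₁ h₃ h x,
    fun h x => coord_str_smul_vec B' B h₂ h₄ h x,
    fun p x => coord_smul_vec_smul_vec B hB B' h₁ h₄ p x, fun p x => coord_smul_vec_smul_vec B' hB' B h₂ h₃ p x⟩

/-! ### Matchings of indexed families -/

theorem exists_equiv_of_map_univ_eq {ι κ α : Type*} [Fintype ι] [Fintype κ] {f : ι → α} {g : κ → α}
    (h : Finset.univ.val.map f = Finset.univ.val.map g) : ∃ e : ι ≃ κ, ∀ i, g (e i) = f i := by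
  classical
  have hcard : ∀ y, Nonempty ({i // f i = y} ≃ {k // g k = y}) := by
    intro y
    have hy := congrArg (Multiset.count y) h
    rw [Multiset.count_map, Multiset.count_map] at hy
    rw [← Fintype.card_eq, Fintype.card_subtype, Fintype.card_subtype]
    simpa only [Finset.card_def, Finset.filter_val, eq_comm] using hy
  exact ⟨Equiv.ofFiberEquiv fun y => (hcard y).some, fun i => Equiv.ofFiberEquiv_map _ i⟩

theorem exists_eq_map_univ {α : Type*} (R : Multiset α) :
    ∃ (n : ℕ) (ρ : Fin n → α), R = Finset.univ.val.map ρ := by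
  induction R using Quotient.inductionOn with
  | h l => exact ⟨l.length, l.get, by simp [Fin.univ_val_map]⟩

open Classical in
theorem map_univ_eq_add {ι κ α : Type*} [Fintype ι] (f : ι → α) {E : Finset κ} {π : κ → ι}
    (h : Set.InjOn π (E : Set κ)) :
    Finset.univ.val.map f = E.val.map (f ∘ π) + (Finset.univ \ E.image π).val.map f := by
  rw [← Multiset.map_map, ← Finset.image_val_of_injOn h, ← Multiset.map_add, Finset.sdiff_val,
    add_tsub_cancel_of_le (Finset.val_le_iff.mpr (Finset.subset_univ _))]

/-- Replaces multisets of isomorphism classes by partial bijections of index sets. Equal multisets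
have equally large fibres, so any indexing of the matched and unmatched classes can be carried over
to `ι` and `κ`. -/
theorem existsMatching_iff {ε : ℝ} {ι κ : Type} [Fintype ι] [Fintype κ] (F : ι → ChainMod K X)
    (G : κ → ChainMod K X) :
    ExistsMatching b ε (Finset.univ.val.map fun i => isoClass (F i))
        (Finset.univ.val.map fun j => isoClass (G j)) ↔
      ∃ E : Finset (ι × κ), Set.InjOn Prod.fst (E : Set (ι × κ)) ∧
        Set.InjOn Prod.snd (E : Set (ι × κ)) ∧
        (∀ e ∈ E, interleavingDist b (F e.1) (G e.2) ≤ ε) ∧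
        (∀ i, (∀ e ∈ E, e.1 ≠ i) → width b (F i) ≤ ε) ∧
        ∀ j, (∀ e ∈ E, e.2 ≠ j) → width b (G j) ≤ ε := by
  classical
  constructor
  · rintro ⟨R, S₀, T₀, hS, hT, hS₀, hT₀, hR⟩
    obtain ⟨n, ρ, rfl⟩ := exists_eq_map_univ R
    obtain ⟨k, s, rfl⟩ := exists_eq_map_univ S₀
    obtain ⟨l, t, rfl⟩ := exists_eq_map_univ T₀
    have hsum : ∀ {m : ℕ} (f : Fin n → IsoClass K X) (g : Fin m → IsoClass K X),
        Finset.univ.val.map f + Finset.univ.val.map g =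
          (Finset.univ : Finset (Fin n ⊕ Fin m)).val.map (Sum.elim f g) := by
      intro m f g
      rw [← Finset.univ_disjSum_univ, Finset.val_disjSum, Multiset.disjSum, Multiset.map_add,
        Multiset.map_map, Multiset.map_map]
      rfl
    rw [Multiset.map_map, hsum] at hS hT
    obtain ⟨e₁, he₁⟩ := exists_equiv_of_map_univ_eq hS
    obtain ⟨e₂, he₂⟩ := exists_equiv_of_map_univ_eq hT
    refine ⟨Finset.univ.image fun x => (e₁.symm (Sum.inl x), e₂.symm (Sum.inl x)),
      ?_, ?_, ?_, ?_, ?_⟩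
    · rw [Finset.coe_image]
      rintro _ ⟨x, -, rfl⟩ _ ⟨y, -, rfl⟩ h
      obtain rfl : x = y := by simpa using h
      rfl
    · rw [Finset.coe_image]
      rintro _ ⟨x, -, rfl⟩ _ ⟨y, -, rfl⟩ h
      obtain rfl : x = y := by simpa using h
      rfl
    · intro e he
      obtain ⟨x, -, rfl⟩ := Finset.mem_image.mp he
      have h₁ := he₁ (e₁.symm (Sum.inl x))
      have h₂ := he₂ (e₂.symm (Sum.inl x))
      rw [Equiv.apply_symm_apply] at h₁ h₂
      have := hR (ρ x) (Multiset.mem_map_of_mem _ (Finset.mem_univ_val _))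
      rw [show (ρ x).1 = _ from h₁, show (ρ x).2 = _ from h₂] at this
      exact this
    · intro i hi
      have h₁ := he₁ i
      rcases h : e₁ i with x | x
      · exact absurd (by simp [← h]) (hi _ (Finset.mem_image_of_mem _ (Finset.mem_univ x)))
      · rw [h] at h₁
        have := hS₀ (s x) (Multiset.mem_map_of_mem _ (Finset.mem_univ_val _))
        rw [show s x = _ from h₁] at this
        exact this
    · intro i hi
      have h₁ := he₂ i
      rcases h : e₂ i with x | x
      · exact absurd (by simp [← h]) (hi _ (Finset.mem_image_of_mem _ (Finset.mem_univ x)))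
      · rw [h] at h₁
        have := hT₀ (t x) (Multiset.mem_map_of_mem _ (Finset.mem_univ_val _))
        rw [show t x = _ from h₁] at this
        exact this
  · rintro ⟨E, h₁, h₂, hE, hF, hG⟩
    refine ⟨E.val.map fun e => (isoClass (F e.1), isoClass (G e.2)),
      (Finset.univ \ E.image Prod.fst).val.map fun i => isoClass (F i),
      (Finset.univ \ E.image Prod.snd).val.map fun j => isoClass (G j), ?_, ?_, ?_, ?_, ?_⟩
    · rw [Multiset.map_map]
      exact map_univ_eq_add _ h₁
    · rw [Multiset.map_map]
      exact map_univ_eq_add _ h₂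
    · intro s hs
      obtain ⟨i, hi, rfl⟩ := Multiset.mem_map.mp hs
      exact hF i fun e he hei => (Finset.mem_sdiff.mp hi).2 (Finset.mem_image.mpr ⟨e, he, hei⟩)
    · intro s hs
      obtain ⟨i, hi, rfl⟩ := Multiset.mem_map.mp hs
      exact hG i fun e he hei => (Finset.mem_sdiff.mp hi).2 (Finset.mem_image.mpr ⟨e, he, hei⟩)
    · intro r hr
      obtain ⟨e, he, rfl⟩ := Multiset.mem_map.mp hr
      exact hE e he

end

section

variable {K : Type u} [Field K] {X : Finset ℝ} {b : ℝ}

/-! ### The isometry theorem for a finite chain -/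

/-- The composite of two sums of morphisms along a partial matching of direct summands. -/
theorem sum_comp_sum_eq {Λ : Translation X} {V W : WithTop X ⥤ FGModuleCat.{u} K}
    {ι κ E : Type} [Fintype ι] [Fintype E] {F : ι → WithTop X ⥤ FGModuleCat.{u} K}
    {G : κ → WithTop X ⥤ FGModuleCat.{u} K} {s : ∀ i, F i ⟶ V} {r : ∀ i, V ⟶ F i}
    (hsum : ∀ p x, ∑ i, comp (s i) p (comp (r i) p x) = x)
    {s' : ∀ j, G j ⟶ W} {r' : ∀ j, W ⟶ G j} (hone : ∀ j, s' j ≫ r' j = 𝟙 (G j))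
    (hzero : ∀ j k, j ≠ k → s' j ≫ r' k = 0)
    {π : E → ι} {π' : E → κ} (hπ : Function.Injective π) (hπ' : Function.Injective π')
    (φ : ∀ e p, (F (π e)).obj p →ₗ[K] (G (π' e)).obj (Λ p))
    (ψ : ∀ e p, (G (π' e)).obj p →ₗ[K] (F (π e)).obj (Λ p))
    (h : ∀ e p x, ψ e (Λ p) (φ e p x) = str (F (π e)) (Λ.le_comp Λ p) x)
    (h₀ : ∀ i, (∀ e, π e ≠ i) → ∀ p x, str (F i) (Λ.le_comp Λ p) x = 0)
    (p : WithTop X) (x : V.obj p) :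
    (∑ e, comp (s (π e)) (Λ (Λ p)) ∘ₗ ψ e (Λ p) ∘ₗ comp (r' (π' e)) (Λ p))
      ((∑ e, comp (s' (π' e)) (Λ p) ∘ₗ φ e p ∘ₗ comp (r (π e)) p) x) =
    str V (Λ.le_comp Λ p) x := by
  -- Orthogonality of the summands of `W` kills the cross terms `e' ≠ e`.
  have hdiag : ∀ e, ∑ e', comp (s (π e)) (Λ (Λ p)) (ψ e (Λ p) (comp (r' (π' e)) (Λ p)
      (comp (s' (π' e')) (Λ p) (φ e' p (comp (r (π e')) p x))))) =
      comp (s (π e)) (Λ (Λ p)) (str _ (Λ.le_comp Λ p) (comp (r (π e)) p x)) := by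
    intro e
    rw [Finset.sum_eq_single e]
    · rw [← h]
      congr 2
      exact congrArg (fun t => comp t (Λ p) _) (hone (π' e))
    · intro e' _ hne
      have : ∀ y, comp (r' (π' e)) (Λ p) (comp (s' (π' e')) (Λ p) y) = 0 := fun y =>
        congrArg (fun t => comp t (Λ p) y) (hzero _ _ fun h => hne (hπ' h))
      rw [this, map_zero, map_zero]
    · exact fun h => absurd (Finset.mem_univ _) h
  simp only [LinearMap.sum_apply, LinearMap.comp_apply, map_sum]
  -- The sum over matched indices extends to all of `ι`, because the unmatched terms vanish by `h₀`.
  rw [Finset.sum_comm, Finset.sum_congr rfl fun e _ => hdiag e,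
    Fintype.sum_of_injective π hπ _ (fun i =>
      comp (s i) (Λ (Λ p)) (str _ (Λ.le_comp Λ p) (comp (r i) p x)))]
  · simp only [comp_str, ← map_sum, hsum]
  · intro i hi
    rw [h₀ i (fun e he => hi ⟨e, he⟩), map_zero]
  · exact fun _ => rfl

theorem interleaved_of_matching {Λ : Translation X} {M N : ChainMod K X} {ι κ : Type}
    [Fintype ι] [Fintype κ] {F : ι → ChainMod K X} {G : κ → ChainMod K X}
    (hF : M.obj ≅ ⨁ fun i => (F i).obj) (hG : N.obj ≅ ⨁ fun j => (G j).obj)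
    {E : Finset (ι × κ)} (h₁ : Set.InjOn Prod.fst (E : Set (ι × κ)))
    (h₂ : Set.InjOn Prod.snd (E : Set (ι × κ)))
    (hE : ∀ e ∈ E, Interleaved Λ Λ (F e.1) (G e.2))
    (hF₀ : ∀ i, (∀ e ∈ E, e.1 ≠ i) → ∀ p x, str (F i).obj (Λ.le_comp Λ p) x = 0)
    (hG₀ : ∀ j, (∀ e ∈ E, e.2 ≠ j) → ∀ p x, str (G j).obj (Λ.le_comp Λ p) x = 0) :
    Interleaved Λ Λ M N := by
  obtain ⟨s, r, hsr, hsr₀, hsum⟩ := exists_retracts hF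
  obtain ⟨s', r', hsr', hsr₀', hsum'⟩ := exists_retracts hG
  simp only [interleaved_iff] at hE
  choose φ ψ hφ hψ h₃ h₄ using fun e : E => hE e e.2
  rw [interleaved_iff]
  refine ⟨fun p => ∑ e : E, comp (s' e.1.2) (Λ p) ∘ₗ φ e p ∘ₗ comp (r e.1.1) p,
    fun p => ∑ e : E, comp (s e.1.1) (Λ p) ∘ₗ ψ e p ∘ₗ comp (r' e.1.2) p, ?_, ?_, ?_, ?_⟩
  · intro p q h x
    simp only [LinearMap.sum_apply, LinearMap.comp_apply, comp_str, hφ, map_sum]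
  · intro p q h x
    simp only [LinearMap.sum_apply, LinearMap.comp_apply, comp_str, hψ, map_sum]
  · exact sum_comp_sum_eq hsum hsr' hsr₀' (fun e e' h => Subtype.ext (h₁ e.2 e'.2 h))
      (fun e e' h => Subtype.ext (h₂ e.2 e'.2 h)) φ ψ h₃
      fun i hi => hF₀ i fun e he => hi ⟨e, he⟩
  · exact sum_comp_sum_eq hsum' hsr hsr₀ (fun e e' h => Subtype.ext (h₂ e.2 e'.2 h))
      (fun e e' h => Subtype.ext (h₁ e.2 e'.2 h)) ψ φ h₄
      fun j hj => hG₀ j fun e he => hj ⟨e, he⟩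

theorem exists_barcode_eq (M : ChainMod K X) :
    ∃ (n : ℕ) (F : Fin n → ChainMod K X), IsDecomposition M F ∧
      barcode M = Finset.univ.val.map fun i => isoClass (F i) :=
  ⟨_, _, (exists_isDecomposition M).choose_spec.choose_spec, rfl⟩

theorem existsMatching_of_interleavingDist_le (hb : 0 < b) {M N : ChainMod K X} {ε : ℝ}
    (h : interleavingDist b M N ≤ ε) : ExistsMatching b ε (barcode M) (barcode N) := by
  have hε : 0 ≤ ε := (interleavingDist_nonneg hb M N).trans h
  rw [interleavingDist_le_iff hb hε] at h
  obtain ⟨m, F, ⟨hF, ⟨f⟩⟩, hM⟩ := exists_barcode_eq M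
  obtain ⟨n, G, ⟨hG, ⟨g⟩⟩, hN⟩ := exists_barcode_eq N
  rw [hM, hN, existsMatching_iff]
  choose a c hac hF using fun i => exists_isInterval (hF i)
  choose a' c' hac' hG using fun j => exists_isInterval (hG j)
  obtain ⟨B⟩ := exists_barBasis f hF
  obtain ⟨B'⟩ := exists_barBasis g hG
  obtain ⟨E, h₁, h₂, hE, hE₁, hE₂⟩ := exists_matching_of_interleaved
    (fun p q => le_maxTranslation_iff hb hε) h B B' (fun i => (hac i).le) fun j => (hac' j).le
  exact ⟨E, h₁, h₂,
    fun e he => (interleavingDist_le_iff hb hε).mpr (interleaved_of_close (hF _) (hG _) (hE e he)),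
    fun i hi => width_le_of_isInterval hb hε (hF i) (hE₁ i hi),
    fun j hj => width_le_of_isInterval hb hε (hG j) (hE₂ j hj)⟩

theorem interleavingDist_le_of_existsMatching (hb : 0 < b) {M N : ChainMod K X} {ε : ℝ}
    (hε : 0 ≤ ε) (h : ExistsMatching b ε (barcode M) (barcode N)) :
    interleavingDist b M N ≤ ε := by
  obtain ⟨m, F, ⟨hF, ⟨f⟩⟩, hM⟩ := exists_barcode_eq M
  obtain ⟨n, G, ⟨hG, ⟨g⟩⟩, hN⟩ := exists_barcode_eq N
  rw [hM, hN, existsMatching_iff] at h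
  obtain ⟨E, h₁, h₂, hE, hE₁, hE₂⟩ := h
  rw [interleavingDist_le_iff hb hε]
  exact interleaved_of_matching f g h₁ h₂
    (fun e he => (interleavingDist_le_iff hb hε).mp (hE e he))
    (fun i hi p x => str_eq_zero_of_width_le hb hε (hE₁ i hi) p x)
    fun j hj p x => str_eq_zero_of_width_le hb hε (hE₂ j hj) p x

theorem interleavingDist_eq_bottleneckDist (hb : 0 < b) (M N : ChainMod K X) :
    interleavingDist b M N = bottleneckDist b M N := by
  -- Only positive `ε` enter the bottleneck metric, so the distance itself may be inadmissible when
  -- it is zero; strictly larger `δ` always work.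
  have hmem : ∀ δ, interleavingDist b M N < δ →
      δ ∈ {ε | 0 < ε ∧ ExistsMatching b ε (barcode M) (barcode N)} := fun δ hδ =>
    ⟨(interleavingDist_nonneg hb M N).trans_lt hδ, existsMatching_of_interleavingDist_le hb hδ.le⟩
  refine le_antisymm (le_csInf ⟨_, hmem _ (lt_add_one _)⟩ fun ε hε =>
    interleavingDist_le_of_existsMatching hb hε.1.le hε.2) (le_of_forall_gt_imp_ge_of_dense
    fun δ hδ => csInf_le ⟨0, fun ε hε => hε.1.le⟩ (hmem δ hδ))

/-- The given `Λ` serves only to bound the distance by its height; the matching comes from the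
largest translation of that height. -/
theorem existsMatching_of_interleaved (hb : 0 < b) {M N : ChainMod K X} {Λ : Translation X}
    (h : Interleaved Λ Λ M N) : ExistsMatching b (Λ.height b) (barcode M) (barcode N) :=
  existsMatching_of_interleavingDist_le hb (sInf_le_of_exists hb ⟨Λ, Λ, le_rfl, le_rfl, h⟩)

/-! ### Inflation is a contraction -/

variable {Y : Finset ℝ}

/-- Only `∞` needs an argument: the two chains have the same maximum, or are both empty. -/
theorem pos_chainIncl (hXY : X ⊆ Y) (hmax : ∀ y ∈ Y, ∃ x ∈ X, y ≤ x) (p : WithTop X) :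
    pos Y b (chainIncl hXY p) = pos X b p := by
  induction p using WithTop.recTopCoe with
  | coe x => rfl
  | top =>
    change pos Y b ⊤ = pos X b ⊤
    by_cases hX : X.Nonempty
    · rw [pos_top X b hX, pos_top Y b (hX.mono hXY)]
      congr 1
      refine le_antisymm (Finset.max'_le _ _ _ fun y hy => ?_) (Finset.max'_subset hX hXY)
      obtain ⟨x, hx, hyx⟩ := hmax y hy
      exact hyx.trans (X.le_max' x hx)
    · have hY : ¬ Y.Nonempty := fun ⟨y, hy⟩ => hX ((hmax y hy).imp fun x hx => hx.1)
      change b + _ = b + _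
      rw [dif_neg hX, dif_neg hY]

theorem floor_translation_le (hXY : X ⊆ Y) {Λ : Translation X} {Λ' : Translation Y}
    (h : ∀ x y, chainIncl hXY x ≤ y → chainIncl hXY (Λ x) ≤ Λ' y) {y : WithTop Y}
    (x : Floor hXY y) (x' : Floor hXY (Λ' y)) : Λ x.1 ≤ x'.1 :=
  x'.2.2 (h x.1 y x.2.1)

end

section

variable {K : Type u} [Field K] {X : Finset ℝ} {b : ℝ} {Y : Finset ℝ}

open Classical in
/-- The inflation of the components of a morphism `V → W Λ`, where `Λ` is dominated by a
translation `Λ'` of the larger chain. -/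
def inflateShift (hXY : X ⊆ Y) {Λ : Translation X} {Λ' : Translation Y}
    (h : ∀ x y, chainIncl hXY x ≤ y → chainIncl hXY (Λ x) ≤ Λ' y)
    {V W : WithTop X ⥤ FGModuleCat.{u} K} (φ : ∀ p, V.obj p →ₗ[K] W.obj (Λ p)) (y : WithTop Y) :
    (∀ x : Floor hXY y, V.obj x.1) →ₗ[K] (∀ x : Floor hXY (Λ' y), W.obj x.1) :=
  LinearMap.pi fun x' =>
    if hy : Nonempty (Floor hXY y) then
      str W (floor_translation_le hXY h hy.some x') ∘ₗ φ _ ∘ₗ LinearMap.proj hy.some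
    else 0

section

variable {hXY : X ⊆ Y} {Λ : Translation X} {Λ' : Translation Y}
  {h : ∀ x y, chainIncl hXY x ≤ y → chainIncl hXY (Λ x) ≤ Λ' y}
  {V W : WithTop X ⥤ FGModuleCat.{u} K} {φ : ∀ p, V.obj p →ₗ[K] W.obj (Λ p)}

theorem inflateShift_apply {y : WithTop Y} (v : ∀ x : Floor hXY y, V.obj x.1) (x : Floor hXY y)
    (x' : Floor hXY (Λ' y)) :
    inflateShift hXY h φ y v x' = str W (floor_translation_le hXY h x x') (φ x.1 (v x)) := by
  have hy : Nonempty (Floor hXY y) := ⟨x⟩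
  obtain rfl : hy.some = x := Subsingleton.elim _ _
  simp only [inflateShift, LinearMap.pi_apply, dif_pos hy]
  rfl

theorem inflateShift_of_isEmpty {y : WithTop Y} (v : ∀ x : Floor hXY y, V.obj x.1)
    (hy : ¬ Nonempty (Floor hXY y)) : inflateShift hXY h φ y v = 0 := by
  funext x'
  simp only [inflateShift, LinearMap.pi_apply, dif_neg hy]
  rfl

theorem inflateStr_of_isEmpty {y₁ y₂ : WithTop Y} (hy : y₁ ≤ y₂)
    (v : ∀ x : Floor hXY y₁, V.obj x.1) (h₁ : ¬ Nonempty (Floor hXY y₁)) :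
    inflateStr hXY V hy v = 0 :=
  funext fun x₂ => inflateStr_apply_of_isEmpty hXY V hy v h₁ x₂

theorem inflateStr_apply_str {y₁ y₂ : WithTop Y} (hy : y₁ ≤ y₂)
    (v : ∀ x : Floor hXY y₁, V.obj x.1) (x₁ : Floor hXY y₁) (x₂ : Floor hXY y₂) :
    inflateStr hXY V hy v x₂ = str V (Floor.mono hy x₁ x₂) (v x₁) :=
  inflateStr_apply hXY V hy v x₁ x₂

theorem inflateShift_inflateStr
    (hφ : ∀ {p q} (h : p ≤ q) x, φ q (str V h x) = str W (Λ.mono h) (φ p x))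
    {y₁ y₂ : WithTop Y} (hy : y₁ ≤ y₂) (v : ∀ x : Floor hXY y₁, V.obj x.1) :
    inflateShift hXY h φ y₂ (inflateStr hXY V hy v) =
      inflateStr hXY W (Λ'.mono hy) (inflateShift hXY h φ y₁ v) := by
  by_cases h₁ : Nonempty (Floor hXY y₁)
  · obtain ⟨x₁⟩ := h₁
    obtain ⟨x₂⟩ := Floor.nonempty_of_le hy x₁
    obtain ⟨x₃⟩ := Floor.nonempty_of_le (Λ'.le_apply y₁) x₁
    funext x₄
    rw [inflateShift_apply _ x₂, inflateStr_apply_str _ _ x₁, inflateStr_apply_str _ _ x₃,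
      inflateShift_apply _ x₁, hφ, str_str, str_str]
  · rw [inflateStr_of_isEmpty _ _ h₁, inflateShift_of_isEmpty _ h₁, map_zero, map_zero]

theorem inflateShift_inflateShift {Γ : Translation X} {Γ' : Translation Y}
    {h' : ∀ x y, chainIncl hXY x ≤ y → chainIncl hXY (Γ x) ≤ Γ' y}
    {ψ : ∀ p, W.obj p →ₗ[K] V.obj (Γ p)}
    (hψ : ∀ {p q} (h : p ≤ q) x, ψ q (str W h x) = str V (Γ.mono h) (ψ p x))
    (hφψ : ∀ p x, ψ (Λ p) (φ p x) = str V (Γ.le_comp Λ p) x) (y : WithTop Y)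
    (v : ∀ x : Floor hXY y, V.obj x.1) :
    inflateShift hXY h' ψ (Λ' y) (inflateShift hXY h φ y v) =
      inflateStr hXY V (Γ'.le_comp Λ' y) v := by
  by_cases h₁ : Nonempty (Floor hXY y)
  · obtain ⟨x₁⟩ := h₁
    obtain ⟨x₂⟩ := Floor.nonempty_of_le (Λ'.le_apply y) x₁
    funext x₃
    rw [inflateShift_apply _ x₂, inflateShift_apply _ x₁, inflateStr_apply_str _ _ x₁, hψ, hφψ,
      str_str, str_str]
  · rw [inflateStr_of_isEmpty _ _ h₁, inflateShift_of_isEmpty _ h₁, map_zero]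

end

/-- At `y` the inflated map applies `φ` at the floor `x` of `y` and then moves from `Λ x` up to the
floor of `Λ' y`. Domination of the translations is exactly what makes this last step possible. -/
theorem Interleaved.inflation (hXY : X ⊆ Y) {Γ Λ : Translation X} {Γ' Λ' : Translation Y}
    (hΓ : ∀ x y, chainIncl hXY x ≤ y → chainIncl hXY (Γ x) ≤ Γ' y)
    (hΛ : ∀ x y, chainIncl hXY x ≤ y → chainIncl hXY (Λ x) ≤ Λ' y) {M N : ChainMod K X}
    (h : Interleaved Γ Λ M N) :
    Interleaved Γ' Λ' ((inflation K hXY).obj M) ((inflation K hXY).obj N) := by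
  rw [interleaved_iff] at h ⊢
  obtain ⟨φ, ψ, hφ, hψ, h₁, h₂⟩ := h
  exact ⟨inflateShift hXY hΛ φ, inflateShift hXY hΓ ψ,
    fun h v => inflateShift_inflateStr hφ h v, fun h v => inflateShift_inflateStr hψ h v,
    fun y v => inflateShift_inflateShift hψ h₁ y v, fun y v => inflateShift_inflateShift hφ h₂ y v⟩

/-- Inflation along an inclusion of chains that does not change the maximum is a contraction. -/
theorem interleavingDist_inflation_le (hb : 0 < b) (hXY : X ⊆ Y)
    (hmax : ∀ y ∈ Y, ∃ x ∈ X, y ≤ x) (M N : ChainMod K X) :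
    interleavingDist b ((inflation K hXY).obj M) ((inflation K hXY).obj N) ≤
      interleavingDist b M N := by
  have hε := interleavingDist_nonneg hb M N
  have key : ∀ x y, chainIncl hXY x ≤ y → chainIncl hXY (maxTranslation X b hb _ hε x) ≤
      maxTranslation Y b hb _ hε y := by
    intro x y hxy
    rw [le_maxTranslation_iff, pos_chainIncl hXY hmax]
    have h₁ := (le_maxTranslation_iff hb hε (p := x)).mp le_rfl
    have h₂ := (pos_le_pos hb).mpr hxy
    rw [pos_chainIncl hXY hmax] at h₂
    linarith
  exact (interleavingDist_le_iff hb hε).mpr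
    (((interleavingDist_le_iff hb hε).mp le_rfl).inflation hXY key key)

/-! ### The shift refinement -/

theorem nonneg_of_mem_distances {ε : ℝ} (h : ε ∈ distances X) : 0 ≤ ε := by
  obtain ⟨p, -, rfl⟩ := Finset.mem_image.mp h
  exact abs_nonneg _

theorem exists_le_of_mem_shiftStep {N Z : Finset ℝ} (hN : ∀ ε ∈ N, 0 ≤ ε) {y z : ℝ}
    (hz : z ∈ shiftStep N Z y) : ∃ z' ∈ Z, z ≤ z' := by
  unfold shiftStep at hz
  split_ifs at hz with h
  · rcases Finset.mem_union.mp hz with hz | hz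
    · exact ⟨z, hz, le_rfl⟩
    · obtain ⟨ε, hε, rfl⟩ := Finset.mem_image.mp hz
      exact ⟨_, (Finset.mem_filter.mp ((Z.filter (· < y)).max'_mem h)).1,
        sub_le_self _ (hN ε hε)⟩
  · exact ⟨z, hz, le_rfl⟩

/-- Each stage of the construction only subtracts nonnegative distances from points already present.
-/
theorem exists_le_of_mem_shiftRefinement {y : ℝ} (hy : y ∈ shiftRefinement X) :
    ∃ x ∈ X, y ≤ x := by
  have fold : ∀ (l : List ℝ) (Z : Finset ℝ), (∀ z ∈ Z, ∃ x ∈ X, z ≤ x) →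
      ∀ z ∈ l.foldl (shiftStep (distances X)) Z, ∃ x ∈ X, z ≤ x := by
    intro l
    induction l with
    | nil => exact fun Z h => h
    | cons y l ih =>
      refine fun Z h => ih _ fun z hz => ?_
      obtain ⟨z', hz', hle⟩ := exists_le_of_mem_shiftStep (fun ε => nonneg_of_mem_distances) hz
      obtain ⟨x, hx, hle'⟩ := h z' hz'
      exact ⟨x, hx, hle.trans hle'⟩
  refine fold _ _ (fun z hz => ?_) y hy
  rcases Finset.mem_union.mp hz with hz | hz
  · exact ⟨z, hz, le_rfl⟩
  · obtain ⟨⟨x, ε⟩, hxε, rfl⟩ := Finset.mem_image.mp hz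
    obtain ⟨hx, hε⟩ := Finset.mem_product.mp hxε
    exact ⟨x, hx, sub_le_self _ (nonneg_of_mem_distances hε)⟩

end

end ShiftIso

end

theorem theorem1 {K : Type u} [Field K] (X : Finset ℝ) (b : ℝ) (hb : 0 < b) :
    -- the identity is an isometry on the (essential) image of `j`
    (∀ M N : ShiftIso.ChainMod K (ShiftIso.shiftRefinement X),
      (ShiftIso.shiftInflation K X).essImage M → (ShiftIso.shiftInflation K X).essImage N →
        ShiftIso.interleavingDist b M N = ShiftIso.bottleneckDist b M N) ∧
    -- `j` is a contraction to the interleaving metric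
    (∀ M N : ShiftIso.ChainMod K X,
      ShiftIso.interleavingDist b ((ShiftIso.shiftInflation K X).obj M)
          ((ShiftIso.shiftInflation K X).obj N) ≤
        ShiftIso.interleavingDist b M N) ∧
    -- `j` is a contraction to the bottleneck metric
    (∀ M N : ShiftIso.ChainMod K X,
      ShiftIso.bottleneckDist b ((ShiftIso.shiftInflation K X).obj M)
          ((ShiftIso.shiftInflation K X).obj N) ≤
        ShiftIso.interleavingDist b M N) ∧
    -- a `(Λ, Λ)`-interleaving on the image of `j` yields a matching of height `h(Λ)`
    (∀ M N : ShiftIso.ChainMod K (ShiftIso.shiftRefinement X),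
      (ShiftIso.shiftInflation K X).essImage M → (ShiftIso.shiftInflation K X).essImage N →
        ∀ Λ : ShiftIso.Translation (ShiftIso.shiftRefinement X), ShiftIso.Interleaved Λ Λ M N →
          ShiftIso.ExistsMatching b (Λ.height b) (ShiftIso.barcode M) (ShiftIso.barcode N)) := by
  refine ⟨fun M N _ _ => ShiftIso.interleavingDist_eq_bottleneckDist hb M N, fun M N => ?_,
    fun M N => ?_, fun M N _ _ Λ h => ShiftIso.existsMatching_of_interleaved hb h⟩
  · exact ShiftIso.interleavingDist_inflation_le hb _
      (fun _ => ShiftIso.exists_le_of_mem_shiftRefinement) M N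
  · rw [← ShiftIso.interleavingDist_eq_bottleneckDist hb]
    exact ShiftIso.interleavingDist_inflation_le hb _
      (fun _ => ShiftIso.exists_le_of_mem_shiftRefinement) M N
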